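/- Let $K$ be an algebraically closed field (of any characteristic), let $B_3=\langle\sigma_1,\sigma_2\mid\sigma_1\sigma_2\sigma_1=\sigma_2\sigma_1\sigma_2\rangle$, and let $1\le d\le 5$. Let $\zeta=(\sigma_1\sigma_2)^3$ (a central element). For a $B_3$-module let $A$ and $B$ be the images of $\sigma_1$ and $\sigma_2$. Parameters. Let $X_d$ be the set of $\lambda=(\lambda_1,\dots,\lambda_d)\in (K^{\times})^d$ if $d\le 3$; of pairs $(\lambda,\gamma^2)$ with $\lambda\in(K^\times)^4$ and $\gamma^2\in K$ a square root of $\lambda_1\lambda_2\lambda_3\lambda_4$ if $d=4$ (the datum is the element $\gamma^2$, not $\gamma$); and of pairs $(\lambda,\gamma)$ with $\lambda\in(K^\times)^5$ and $\gamma^5=\lambda_1\cdots\lambda_5$ if $d=5$. The symmetric group $S_d$ acts on $X_d$ by permuting the $\lambda_i$. A $d$-dimensional $B_3$-module $V$ has parameter $x\in X_d$ if the characteristic polynomial of $A$ is $\prod_i(t-\lambda_i)$ and moreover $\zeta$ acts on $V$ as the scalar $-(\gamma^2)^3$ if $d=4$, and as the scalar $\gamma^6$ if $d=5$. For $r\ne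 s$ put $$Q^{(2)}_{rs}=-\lambda_r^2+\lambda_r\lambda_s-\lambda_s^2,\qquad Q^{(3)}_{rs}=(\lambda_r^2+\lambda_s\lambda_k)(\lambda_s^2+\lambda_r\lambda_k)\quad(\{r,s,k\}=\{1,2,3\}),$$ $$Q^{(4)}_{rs}=-\gamma^{-2}(\lambda_r^2+\gamma^2)(\lambda_s^2+\gamma^2)(\gamma^2+\lambda_r\lambda_k+\lambda_s\lambda_l)(\gamma^2+\lambda_r\lambda_l+\lambda_s\lambda_k)\quad(\{r,s,k,l\}=\{1,2,3,4\}),$$ $$Q^{(5)}_{rs}=\gamma^{-8}(\gamma^2+\lambda_r\gamma+\lambda_r^2)(\gamma^2+\lambda_s\gamma+\lambda_s^2)\prod_{k\ne r,s}(\gamma^2+\lambda_r\lambda_k)(\gamma^2+\lambda_s\lambda_k).$$ Theorem. (a) Every simple $B_3$-module of dimension $d$ has a parameter in $X_d$, and its parameters form exactly one $S_d$-orbit. Two simple $B_3$-modules of dimension $d$ are equivalent if and only if they have a common parameter; that is, a simple module is determined up to equivalence by the eigenvalues of $A$ together with, for $d=4$, the square root $\gamma^2$ of $\det A$ and, for $d=5$,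 the fifth root $\gamma$ of $\det A$. (b) For $x\in X_d$ a simple $B_3$-module of dimension $d$ with parameter $x$ exists if and only if $Q_{rs}^{(d)}(x)\ne 0$ for all $r\ne s$ in $\{1,\dots,d\}$ (no condition for $d=1$). The $\lambda_i$ need not be distinct. (c) With $P_r(t)=\prod_{i\ne r}(t-\lambda_i)$, every simple module with parameter $x$ satisfies $P_r(A)\neq 0$ and $P_r(A)P_s(B)P_r(A)=Q_{rs}^{(d)}(x)\,P_r(A)$ for all $r\ne s$. (d) Let $N_d$ be the set of points at which at least one of the following polynomials vanishes: none for $d=1$; $\lambda_1^2-\lambda_1\lambda_2+\lambda_2^2$ for $d=2$; $\lambda_i^2+\lambda_r\lambda_s$ with $\{i,r,s\}=\{1,2,3\}$ for $d=3$; $\lambda_i^2+\gamma^2$ $(1\le i\le 4)$ and $\gamma^2+\lambda_i\lambda_j+\lambda_r\lambda_s$ with $\{i,j,r,s\}=\{1,2,3,4\}$ for $d=4$; $\gamma^2+\gamma\lambda_i+\lambda_i^2$ $(1\le i\le 5)$ and $\gamma^2+\lambda_i\lambda_j$ $(1\le i<j\le 5)$ for $d=5$. There is a bijection between the equivalence classes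 of simple $B_3$-modules of dimension $d$ and the $S_d$-orbits in $X_d\setminus N_d$ under which the class of $V$ corresponds to the orbit of $x$ if and only if $V$ has parameter $x$. -/

import Mathlib

open Polynomial

/-- The braid relation `σ₁σ₂σ₁ = σ₂σ₁σ₂`, as a one-element set of relators in the free group
on `σ₁` (index `0`) and `σ₂` (index `1`). -/
def braidRelators : Set (FreeGroup (Fin 2)) :=
  {FreeGroup.of 0 * FreeGroup.of 1 * FreeGroup.of 0 *
    (FreeGroup.of 1 * FreeGroup.of 0 * FreeGroup.of 1)⁻¹}

/-- Artin's braid group on three strands. -/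
abbrev B3 : Type := PresentedGroup braidRelators

namespace B3

/-- The first standard generator. -/
def σ₁ : B3 := PresentedGroup.of 0

/-- The second standard generator. -/
def σ₂ : B3 := PresentedGroup.of 1

/-- The central element `(σ₁σ₂)³`. -/
def ζ : B3 := (σ₁ * σ₂) ^ 3

/-- Pairs `(l, g)`: the list `l` of eigenvalues and the extra parameter `g`, which is the square
root `γ²` of the determinant for `d = 4` and the fifth root `γ` of the determinant for `d = 5`.
For the other `d` there is no extra parameter, and `g` is the constant `1`
(see `paramSpace`). -/
abbrev Param (K : Type*) (d : ℕ) : Type _ := (Fin d → K) × K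

section

variable {K : Type*} [Field K]

/-- The condition on the extra parameter. -/
def IsRoot : {d : ℕ} → Param K d → Prop
  | 4, (l, g) => g ^ 2 = ∏ i, l i
  | 5, (l, g) => g ^ 5 = ∏ i, l i
  | _, (_, g) => g = 1

variable (K) in
/-- The parameter space `X_d`: nonzero eigenvalues together with a choice of root. -/
def paramSpace (d : ℕ) : Set (Param K d) :=
  {p | (∀ i, p.1 i ≠ 0) ∧ IsRoot p}

/-- The Laurent polynomials `Q_{rs}^{(d)}` (only meaningful for `r ≠ s` and `2 ≤ d ≤ 5`).
For `r ≠ s` the product for `d = 3` has one factor, and the product over ordered pairs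
`(k, m)` with `{r, s, k, m} = {1, 2, 3, 4}` for `d = 4` has two. -/
def Q : {d : ℕ} → Param K d → Fin d → Fin d → K
  | 2, (l, _), r, s => -l r ^ 2 + l r * l s - l s ^ 2
  | 3, (l, _), r, s =>
      ∏ k ∈ ({r, s} : Finset (Fin 3))ᶜ, ((l r ^ 2 + l s * l k) * (l s ^ 2 + l r * l k))
  | 4, (l, g), r, s =>
      -g⁻¹ * (l r ^ 2 + g) * (l s ^ 2 + g) *
        ∏ p ∈ (({r, s} : Finset (Fin 4))ᶜ).offDiag, (g + l r * l p.1 + l s * l p.2)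
  | 5, (l, g), r, s =>
      (g ^ 8)⁻¹ * (g ^ 2 + l r * g + l r ^ 2) * (g ^ 2 + l s * g + l s ^ 2) *
        ∏ k ∈ ({r, s} : Finset (Fin 5))ᶜ, ((g ^ 2 + l r * l k) * (g ^ 2 + l s * l k))
  | _, _, _, _ => 1

/-- `p` is a zero of one of the polynomials that cut out the excluded locus. -/
def IsExcluded : {d : ℕ} → Param K d → Prop
  | 2, (l, _) => l 0 ^ 2 - l 0 * l 1 + l 1 ^ 2 = 0
  | 3, (l, _) => ∃ i r s : Fin 3, i ≠ r ∧ i ≠ s ∧ r ≠ s ∧ l i ^ 2 + l r * l s = 0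
  | 4, (l, g) => (∃ i, l i ^ 2 + g = 0) ∨
      ∃ i j r s : Fin 4, [i, j, r, s].Nodup ∧ g + l i * l j + l r * l s = 0
  | 5, (l, g) => (∃ i, g ^ 2 + g * l i + l i ^ 2 = 0) ∨
      ∃ i j : Fin 5, i < j ∧ g ^ 2 + l i * l j = 0
  | _, _ => False

variable (K) in
/-- The excluded locus `N_d`. -/
def excludedLocus (d : ℕ) : Set (Param K d) := {p | IsExcluded p}

/-- Two parameters are in the same orbit of the symmetric group, which permutes the
eigenvalues and fixes the extra parameter. -/
def SameOrbit {d : ℕ} (p q : Param K d) : Prop :=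
  ∃ π : Equiv.Perm (Fin d), q.1 = p.1 ∘ π ∧ q.2 = p.2

variable (K) in
/-- The orbit relation on `X_d \ N_d`. -/
def orbitSetoid (d : ℕ) : Setoid ↥(paramSpace K d \ excludedLocus K d) where
  r p q := SameOrbit p.1 q.1
  iseqv :=
    { refl := fun _ => ⟨1, rfl, rfl⟩
      symm := by
        rintro p q ⟨π, h1, h2⟩
        refine ⟨π⁻¹, ?_, h2.symm⟩
        rw [h1]
        funext i
        simp
      trans := by
        rintro p q r ⟨π, h1, h2⟩ ⟨τ, h3, h4⟩
        refine ⟨π * τ, ?_, h4.trans h2⟩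
        rw [h3, h1]
        rfl }

variable (K) in
/-- The set of orbits of the symmetric group in `X_d \ N_d`. -/
abbrev ParamOrbits (d : ℕ) : Type _ := Quotient (orbitSetoid K d)

/-- How the central element acts in a representation whose extra parameter is `g`. -/
def CentralCondition {V : Type*} [AddCommGroup V] [Module K V] (ρ : Representation K B3 V) :
    {d : ℕ} → Param K d → Prop
  | 4, (_, g) => ρ ζ = (-g ^ 3) • (1 : Module.End K V)
  | 5, (_, g) => ρ ζ = (g ^ 6) • (1 : Module.End K V)
  | _, _ => True

/-- `ρ` has parameter `p = (l, g)`: the eigenvalues of `A = ρ σ₁` with multiplicity are the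
`l i`, and `g` is the root of `det A` that belongs to `ρ`: the central element acts as the scalar
`-(γ²)³` for `d = 4` and `γ⁶` for `d = 5`. -/
structure HasParam {V : Type*} [AddCommGroup V] [Module K V] [FiniteDimensional K V]
    (ρ : Representation K B3 V) {d : ℕ} (p : Param K d) : Prop where
  charpoly_eq : LinearMap.charpoly (ρ σ₁) = ∏ i, (X - C (p.1 i))
  mem : p ∈ paramSpace K d
  central : CentralCondition ρ p

/-- The polynomial `P_r(x) = ∏_{i ≠ r} (x - l i)`. -/
noncomputable def P {d : ℕ} (l : Fin d → K) (r : Fin d) : K[X] :=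
  ∏ i ∈ Finset.univ.erase r, (X - C (l i))

variable (K) in
/-- Equivalence of simple representations of `B3` on `K^d`. -/
def simpleSetoid (d : ℕ) :
    Setoid {ρ : Representation K B3 (Fin d → K) // ρ.IsIrreducible} where
  r ρ τ := Nonempty (ρ.1.Equiv τ.1)
  iseqv :=
    { refl := fun ρ => ⟨.refl ρ.1⟩
      symm := fun ⟨e⟩ => ⟨e.symm⟩
      trans := fun ⟨e⟩ ⟨f⟩ => ⟨e.trans f⟩ }

variable (K) in
/-- The set of equivalence classes of simple `B3`-modules of dimension `d`
(each of them is represented on `K^d`). -/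
abbrev SimpleClasses (d : ℕ) : Type _ := Quotient (simpleSetoid K d)

end

end B3

/-!
Put `δ = σ₁σ₂σ₁` and `τ = σ₁σ₂`, so that `δ² = τ³ = ζ` acts on a simple module as a scalar. If the
dimension is at most `5`, the eigenspaces of `σ₁` are lines: two independent eigenvectors with the
same eigenvalue would make `δ` and `τ` share a proper invariant subspace. For an eigenvector `u` of
`σ₁` and a suitable vector `w`, the first `d` of the vectors `u`, `τ u`, `τ² u`, `w`, `τ w` form a
basis, in which `δ` and `τ` have matrices that depend only on the eigenvalue of `u`, the cofactor of
that eigenvalue in the characteristic polynomial of `σ₁`, and the extra root `γ`. Hence the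
parameter determines the module.

In this model one checks `P_r(A) P_s(B) u = Q_rs u` when `r`, `s` are the first two indices, and
symmetry gives the other pairs. Conjugation by `δ` exchanges `A` and `B`, so `δ P_s(B) u` is an
eigenvector of `A` for `λ_s` as soon as `P_s(B) u ≠ 0`; applying this to `(r, s)` and then to
`(s, r)` shows that `Q_rs = 0` is impossible in a simple module. Conversely, a proper invariant
subspace of the model factors the characteristic polynomial, and then `P_r(A) P_s(B) = 0` or
`P_s(B) P_r(A) = 0` for the first index `r` and some `s`, which forces `Q_rs = 0`.
-/

namespace B3

section Pair

variable {K V : Type*} [Field K] [AddCommGroup V] [Module K V]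

/-- Operators `S`, `T` with `S ^ 2 = T ^ 3 = c ≠ 0` and without common invariant subspaces. These
are the images of `σ₁σ₂σ₁` and `σ₁σ₂` in a simple `B3`-module. -/
structure IsSimplePair (c : K) (S T : Module.End K V) : Prop where
  ne_zero : c ≠ 0
  sq : ∀ v, S (S v) = c • v
  cube : ∀ v, T (T (T v)) = c • v
  eq_bot_or_eq_top : ∀ N : Submodule K V, (∀ v ∈ N, S v ∈ N) → (∀ v ∈ N, T v ∈ N) →
    N = ⊥ ∨ N = ⊤

namespace IsSimplePair

variable {c l : K} {S T : Module.End K V}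

theorem injective_T (h : IsSimplePair c S T) : Function.Injective T := by
  intro v w hvw
  have hTT := congrArg (fun x => T (T x)) hvw
  simp only [h.cube] at hTT
  exact smul_right_injective V h.ne_zero hTT

theorem apply_S_apply_T (h : IsSimplePair c S T) (hl : l ≠ 0) {u : V} (hu : S u = l • T u) :
    S (T u) = (c / l) • u := by
  have hS := h.sq u
  rw [hu, map_smul] at hS
  rw [div_eq_inv_mul, mul_smul, ← hS, smul_smul, inv_mul_cancel₀ hl, one_smul]

theorem finrank_le_of_forall_mem_span (h : IsSimplePair c S T) {n : ℕ} {v : Fin n → V} (i : Fin n)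
    (hi : v i ≠ 0) (hS : ∀ j, S (v j) ∈ Submodule.span K (Set.range v))
    (hT : ∀ j, T (v j) ∈ Submodule.span K (Set.range v)) : Module.finrank K V ≤ n := by
  have stable {f : Module.End K V} (hf : ∀ j, f (v j) ∈ Submodule.span K (Set.range v)) :
      ∀ x ∈ Submodule.span K (Set.range v), f x ∈ Submodule.span K (Set.range v) :=
    show Submodule.span K (Set.range v) ≤ (Submodule.span K (Set.range v)).comap f from
      Submodule.span_le.2 (Set.range_subset_iff.2 hf)
  have hvi : v i ∈ Submodule.span K (Set.range v) := Submodule.subset_span ⟨i, rfl⟩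
  rcases h.eq_bot_or_eq_top _ (stable hS) (stable hT) with hbot | htop
  · exact absurd ((Submodule.mem_bot K).1 (hbot ▸ hvi)) hi
  · rw [← finrank_top K V, ← htop]
    exact (finrank_range_le_card v).trans_eq (Fintype.card_fin n)

theorem finrank_le_one (h : IsSimplePair c S T) {u : V} (hu0 : u ≠ 0) (hu : S u = l • T u)
    (hT : T u ∈ Submodule.span K (Set.range ![u])) : Module.finrank K V ≤ 1 :=
  h.finrank_le_of_forall_mem_span 0 hu0 (Fin.forall_fin_one.2 (hu ▸ Submodule.smul_mem _ _ hT))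
    (Fin.forall_fin_one.2 hT)

theorem finrank_le_two (h : IsSimplePair c S T) (hl : l ≠ 0) {u : V}
    (hu0 : u ≠ 0) (hu : S u = l • T u) (hT : T (T u) ∈ Submodule.span K (Set.range ![u, T u])) :
    Module.finrank K V ≤ 2 := by
  have mem (j : Fin 2) : ![u, T u] j ∈ Submodule.span K (Set.range ![u, T u]) :=
    Submodule.subset_span ⟨j, rfl⟩
  refine h.finrank_le_of_forall_mem_span 0 hu0 (Fin.forall_fin_two.2 ⟨?_, ?_⟩)
    (Fin.forall_fin_two.2 ⟨mem 1, hT⟩)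
  · exact hu ▸ Submodule.smul_mem _ _ (mem 1)
  · exact h.apply_S_apply_T hl hu ▸ Submodule.smul_mem _ _ (mem 0)

theorem finrank_le_one_of_apply_T (h : IsSimplePair c S T) (hl : l ≠ 0) {v : V} (hv0 : v ≠ 0)
    (hv : S v = l • T v) (hTv : S (T v) = l • T (T v)) : Module.finrank K V ≤ 1 := by
  have hc := h.ne_zero
  have hTT : T (T v) = (c / l ^ 2) • v := by
    rw [h.apply_S_apply_T hl hv] at hTv
    rw [← inv_smul_smul₀ hl (T (T v)), ← hTv, smul_smul]
    congr 1
    field_simp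
  have hT : T v = (l ^ 2) • v := by
    have hTTT := h.cube v
    rw [hTT, map_smul] at hTTT
    rw [← inv_smul_smul₀ (div_ne_zero hc (pow_ne_zero 2 hl)) (T v), hTTT, smul_smul]
    congr 1
    field_simp
  refine h.finrank_le_one hv0 hv ?_
  rw [hT]
  exact Submodule.smul_mem _ _ (Submodule.subset_span ⟨0, rfl⟩)

theorem finrank_le_two_of_apply_T_apply_T (h : IsSimplePair c S T) (hl : l ≠ 0) {x w : V} {a : K}
    (hx0 : x ≠ 0) (hx : S x = l • T x) (hw : S w = l • T w) (hT : T (T x) = w + a • T x) :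
    Module.finrank K V ≤ 2 := by
  have hTy : T (w + a ^ 2 • x) = c • x - a • w := by
    have hTTT := h.cube x
    rw [hT, map_add, map_smul, hT] at hTTT
    rw [map_add, map_smul, ← hTTT]
    module
  have hy : S (w + a ^ 2 • x) = l • T (w + a ^ 2 • x) := by
    simp only [map_add, map_smul, hw, hx]
    module
  have hSTy : S (c • x - a • w) = l • T (c • x - a • w) := by
    simp only [map_sub, map_smul, hw, hx]
    module
  by_cases hy0 : w + a ^ 2 • x = 0
  · refine h.finrank_le_two hl hx0 hx ?_
    rw [Matrix.range_cons, Matrix.range_cons, Matrix.range_empty, Set.union_empty,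
      Set.singleton_union, Submodule.mem_span_pair]
    exact ⟨-a ^ 2, a, by rw [hT, eq_neg_of_add_eq_zero_left hy0, neg_smul]⟩
  · rw [← hTy] at hSTy
    exact (h.finrank_le_one_of_apply_T hl hy0 hy hSTy).trans one_le_two

theorem finrank_le_two_of_mem_span_pair [IsAlgClosed K] (h : IsSimplePair c S T) (hl : l ≠ 0)
    {x z w : V} (hx : S x = l • T x) (hz : S z = l • T z) (hxz : LinearIndependent K ![x, z])
    (hw : w ∈ Submodule.span K {x, z}) (hT : T (T x) = w + T z) : Module.finrank K V ≤ 2 := by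
  obtain ⟨p, q, rfl⟩ := Submodule.mem_span_pair.1 hw
  -- `m` is chosen so that `T (T y)` is an eigenvector plus a multiple of `T y` for `y = z - m • x`.
  obtain ⟨m, hm⟩ := IsAlgClosed.exists_root (C 1 * X ^ 2 + C q * X + C p : K[X])
    (by rw [degree_quadratic one_ne_zero]; exact two_ne_zero)
  have hp : p = -(q + m) * m := by
    simp only [IsRoot.def, eval_add, eval_pow, eval_X, eval_mul, eval_C] at hm
    linear_combination hm
  have hy0 : z - m • x ≠ 0 := fun h0 =>
    (LinearIndependent.pair_iff' (by simpa using hxz.ne_zero 0)).1 hxz m (sub_eq_zero.1 h0).symm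
  have hTz : T (T z) = c • x - T (p • x + q • z) := by
    rw [← h.cube x, hT, map_add, add_sub_cancel_left]
  refine h.finrank_le_two_of_apply_T_apply_T hl (w := c • x - m • (p • x + q • z))
    (a := -(q + m)) hy0 ?_ ?_ ?_
  · simp only [map_sub, map_smul, hz, hx]
    module
  · simp only [map_sub, map_add, map_smul, hz, hx]
    module
  · rw [map_sub, map_sub, map_smul, map_smul, hTz, hT, hp]
    simp only [map_add, map_smul]
    module

theorem finrank_map_T (h : IsSimplePair c S T) (N : Submodule K V) :
    Module.finrank K (N.map T) = Module.finrank K N :=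
  (Submodule.equivMapOfInjective T h.injective_T N).finrank_eq.symm

section FiniteDimensional

variable [FiniteDimensional K V]

theorem finrank_ker_sup_map_T (h : IsSimplePair c S T) (hd : 1 < Module.finrank K V) (hl : l ≠ 0) :
    Module.finrank K ↥(LinearMap.ker (S - l • T) ⊔ (LinearMap.ker (S - l • T)).map T) =
      2 * Module.finrank K (LinearMap.ker (S - l • T)) := by
  have hdisj : Disjoint (LinearMap.ker (S - l • T)) ((LinearMap.ker (S - l • T)).map T) := by
    rw [Submodule.disjoint_def]
    rintro _ hTv ⟨v, hv, rfl⟩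
    have hv0 : v = 0 := by
      by_contra hv0
      exact hd.not_ge (h.finrank_le_one_of_apply_T hl hv0 (sub_eq_zero.1 hv) (sub_eq_zero.1 hTv))
    rw [hv0, map_zero]
  have hsum := Submodule.finrank_sup_add_finrank_inf_eq (LinearMap.ker (S - l • T))
    ((LinearMap.ker (S - l • T)).map T)
  rw [hdisj.eq_bot, finrank_bot, h.finrank_map_T] at hsum
  omega

theorem exists_apply_T_apply_T_eq_add (h : IsSimplePair c S T) (hd : Module.finrank K V ≤ 5)
    (hl : l ≠ 0) (hW : 2 ≤ Module.finrank K (LinearMap.ker (S - l • T))) :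
    Module.finrank K (LinearMap.ker (S - l • T)) = 2 ∧ 2 < Module.finrank K V ∧
      ∃ x ∈ LinearMap.ker (S - l • T), ∃ z ∈ LinearMap.ker (S - l • T),
        ∃ w ∈ LinearMap.ker (S - l • T), x ≠ 0 ∧ T (T x) = w + T z := by
  have hWle := Submodule.finrank_le (LinearMap.ker (S - l • T))
  have hU := h.finrank_ker_sup_map_T (hW.trans hWle) hl
  set W := LinearMap.ker (S - l • T)
  have hUle := Submodule.finrank_le (W ⊔ W.map T)
  have hne : (W ⊔ W.map T) ⊓ (W.map T).map T ≠ ⊥ := by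
    intro hbot
    have hsum := Submodule.finrank_sup_add_finrank_inf_eq (W ⊔ W.map T) ((W.map T).map T)
    rw [hbot, finrank_bot, h.finrank_map_T, h.finrank_map_T] at hsum
    have hle := Submodule.finrank_le ((W ⊔ W.map T) ⊔ (W.map T).map T)
    omega
  obtain ⟨_, ⟨hyU, _, ⟨x, hx, rfl⟩, rfl⟩, hy0⟩ := Submodule.exists_mem_ne_zero_of_ne_bot hne
  obtain ⟨w, hw, _, ⟨z, hz, rfl⟩, hwz⟩ := Submodule.mem_sup.1 hyU
  refine ⟨by omega, by omega, x, hx, z, hz, w, hw, ?_, hwz.symm⟩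
  rintro rfl
  exact hy0 (by rw [map_zero, map_zero])

/-- If the eigenspace `W` had dimension `2`, then `W ⊕ T W` would have dimension `4` and meet
`T² W`; the resulting relation `T² x ∈ W + T W` yields an invariant plane. -/
theorem finrank_ker_le_one [IsAlgClosed K] (h : IsSimplePair c S T) (hd : Module.finrank K V ≤ 5)
    (hl : l ≠ 0) : Module.finrank K (LinearMap.ker (S - l • T)) ≤ 1 := by
  by_contra! hW
  obtain ⟨hW2, hd2, x, hx, z, hz, w, hw, hx0, hT⟩ := h.exists_apply_T_apply_T_eq_add hd hl hW
  refine hd2.not_ge ?_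
  by_cases hxz : LinearIndependent K ![x, z]
  · have hspan : Submodule.span K {x, z} = LinearMap.ker (S - l • T) := by
      refine Submodule.eq_of_le_of_finrank_eq (Submodule.span_le.2 (Set.pair_subset hx hz)) ?_
      have hcard := finrank_span_eq_card hxz
      rw [Matrix.range_cons, Matrix.range_cons, Matrix.range_empty, Set.union_empty,
        Set.singleton_union, Fintype.card_fin] at hcard
      exact hcard.trans hW2.symm
    exact h.finrank_le_two_of_mem_span_pair hl (sub_eq_zero.1 hx) (sub_eq_zero.1 hz) hxz
      (hspan ▸ hw) hT
  · rw [LinearIndependent.pair_iff' hx0] at hxz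
    push Not at hxz
    obtain ⟨a, rfl⟩ := hxz
    exact h.finrank_le_two_of_apply_T_apply_T hl hx0 (sub_eq_zero.1 hx) (sub_eq_zero.1 hw)
      (hT.trans (by rw [map_smul]))

theorem exists_smul_eq [IsAlgClosed K] (h : IsSimplePair c S T) (hd : Module.finrank K V ≤ 5)
    (hl : l ≠ 0) {u v : V} (hu0 : u ≠ 0) (hu : S u = l • T u) (hv : S v = l • T v) :
    ∃ a : K, a • u = v := by
  have hu' : (⟨u, sub_eq_zero.2 hu⟩ : LinearMap.ker (S - l • T)) ≠ 0 :=
    fun h0 => hu0 (congrArg Subtype.val h0)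
  have hpos := (Module.finrank_pos_iff_exists_ne_zero (R := K)).2 ⟨_, hu'⟩
  obtain ⟨a, ha⟩ := (finrank_eq_one_iff_of_nonzero' _ hu').1
    (le_antisymm (h.finrank_ker_le_one hd hl) hpos) ⟨v, sub_eq_zero.2 hv⟩
  exact ⟨a, congrArg Subtype.val ha⟩

end FiniteDimensional

end IsSimplePair

end Pair

section Model

variable {K : Type*} [Field K]

/-- The exponent `k` such that the extra parameter is a `k`-th root of the determinant, where for
`d ≤ 3` the determinant itself is taken as the extra parameter (compare `root`). -/
def rootDegree : ℕ → ℕ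
  | 4 => 2
  | 5 => 5
  | _ => 1

/-- The monic polynomial `f` of degree `d - 1` can be the cofactor of `X - l` in the characteristic
polynomial of an operator on `K ^ d` of determinant `g ^ rootDegree d`. -/
structure IsCofactor (d : ℕ) (l g : K) (f : K[X]) : Prop where
  monic : f.Monic
  natDegree_eq : f.natDegree + 1 = d
  mul_coeff_zero : l * f.coeff 0 = (-1) ^ f.natDegree * g ^ rootDegree d

/-- The scalar by which `ζ` acts in the model. -/
def modelScalar : ℕ → K → K
  | 1, g => g ^ 6
  | 2, g => -g ^ 3
  | 3, g => g ^ 2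
  | 4, g => -g ^ 3
  | 5, g => g ^ 6
  | _, _ => 1

/-- The matrix of `σ₁σ₂σ₁` in the model: the normal form of a simple module of dimension `d ≤ 5`
with respect to the basis made of the first `d` vectors among `u`, `T u`, `T² u`, `w`, `T w`, where
`u` is an eigenvector of `σ₁` with eigenvalue `l`, `T` is the action of `σ₁σ₂`, and `σ₁σ₂σ₁` maps
`w` to `T² u`. The characteristic polynomial of `σ₁` is `(X - l) f`. -/
noncomputable def modelS : (d : ℕ) → (l g : K) → K[X] → Matrix (Fin d) (Fin d) K
  | 1, _, g, _ => !![g ^ 3]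
  | 2, l, g, _ => !![0, -g ^ 3 / l; l, 0]
  | 3, l, g, f => !![0, g ^ 2 / l, -g ^ 2 * f.coeff 1; l, 0, -l * g * f.coeff 1; 0, 0, -g]
  | 4, l, g, _ => !![0, -g ^ 3 / l, 0, 0; l, 0, 0, 0; 0, 0, 0, 1; 0, 0, -g ^ 3, 0]
  | 5, l, g, f =>
      let b := f.coeff 1 - g * f.coeff 2 + g ^ 3 / l * f.coeff 3 - g ^ 4 / l
      let e := l * f.coeff 1 / g ^ 2 - g ^ 2
      !![0, g ^ 6 / l, 0, 0, -g ^ 3 * b; l, 0, 0, 0, l * b; 0, 0, 0, 1, e;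
        0, 0, g ^ 6, 0, -g ^ 3 * e; 0, 0, 0, 0, g ^ 3]
  | _, _, _, _ => 1

/-- The matrix of `σ₁σ₂` in the model, see `modelS`. -/
noncomputable def modelT : (d : ℕ) → (l g : K) → K[X] → Matrix (Fin d) (Fin d) K
  | 1, _, g, _ => !![g ^ 2]
  | 2, _, g, _ => !![0, -g ^ 2; 1, g]
  | 3, _, g, _ => !![0, 0, g ^ 2; 1, 0, 0; 0, 1, 0]
  | 4, l, g, f => !![0, 0, -g ^ 3, -g * f.coeff 2; 1, 0, 0, l * f.coeff 1 / g - f.coeff 2;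
      0, 1, 0, l * f.coeff 1 / g ^ 2; 0, 0, 0, -g]
  | 5, l, g, f =>
      let a := g - l * f.coeff 1 / g ^ 3 - f.coeff 3
      !![0, 0, g ^ 6, 0, g ^ 4 * a; 1, 0, 0, 0, g ^ 2 * a; 0, 1, 0, 0, a; 0, 0, 0, 0, -g ^ 4;
        0, 0, 0, 1, -g ^ 2]
  | _, _, _, _ => 1

/-- The matrix of `σ₂` in the model, see `modelS`. -/
noncomputable def modelB : (d : ℕ) → (l g : K) → K[X] → Matrix (Fin d) (Fin d) K
  | 1, _, g, _ => !![g]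
  | 2, l, g, _ => !![g / l, 0; l / g, l]
  | 3, l, g, f => !![-f.coeff 1, 0, g ^ 2 / l; -l / g * f.coeff 1, l, 0; -g⁻¹, 0, 0]
  | 4, l, g, f => !![0, 0, -g ^ 3 / l, -f.coeff 1;
      0, l, 0, l ^ 2 / g ^ 2 * f.coeff 1 - l / g * f.coeff 2; 0, 0, 0, -g⁻¹; 1, 0, 0, -f.coeff 2]
  | 5, l, g, f =>
      let a := g - l * f.coeff 1 / g ^ 3 - f.coeff 3
      !![0, 0, g ^ 6 / l, -f.coeff 2, 0; 0, l, 0, (l + g) * a / g ^ 2 + l * f.coeff 2 / g ^ 3, 0;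
        0, 0, 0, -l * f.coeff 1 / g ^ 6, 1; 1, 0, 0, -f.coeff 3, 0; 0, 0, 0, -g⁻¹, 0]
  | _, _, _, _ => 1

theorem modelScalar_ne_zero (d : ℕ) {g : K} (hg : g ≠ 0) : modelScalar d g ≠ 0 := by
  unfold modelScalar
  split <;> simp [hg]

theorem modelS_mul_modelS (d : ℕ) {l g : K} (f : K[X]) (hl : l ≠ 0) (hg : g ≠ 0) :
    modelS d l g f * modelS d l g f = modelScalar d g • 1 := by
  match d with
  | 0 => exact Subsingleton.elim _ _
  | 1 | 2 | 3 | 4 | 5 =>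
    refine Matrix.mulVec_injective (funext fun v => ?_)
    rw [← Matrix.mulVec_mulVec, Matrix.smul_mulVec, Matrix.one_mulVec]
    ext i
    fin_cases i <;>
      simp [modelS, modelScalar, Matrix.mulVec, dotProduct, Fin.sum_univ_succ] <;> field_simp <;>
      ring
  | _ + 6 => simp [modelS, modelScalar]

theorem modelT_mul_modelT_mul_modelT (d : ℕ) (l : K) {g : K} (f : K[X]) (hg : g ≠ 0) :
    modelT d l g f * (modelT d l g f * modelT d l g f) = modelScalar d g • 1 := by
  match d with
  | 0 => exact Subsingleton.elim _ _
  | 1 | 2 | 3 | 4 | 5 =>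
    refine Matrix.mulVec_injective (funext fun v => ?_)
    rw [← Matrix.mulVec_mulVec, ← Matrix.mulVec_mulVec, Matrix.smul_mulVec, Matrix.one_mulVec]
    ext i
    fin_cases i <;>
      simp [modelT, modelScalar, Matrix.mulVec, dotProduct, Fin.sum_univ_succ] <;> field_simp <;>
      ring
  | _ + 6 => simp [modelT, modelScalar]

theorem modelB_mul_modelT (d : ℕ) {l g : K} (f : K[X]) (hl : l ≠ 0) (hg : g ≠ 0) :
    modelB d l g f * modelT d l g f = modelS d l g f := by
  match d with
  | 0 => exact Subsingleton.elim _ _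
  | 1 | 2 | 3 | 4 | 5 =>
    refine Matrix.mulVec_injective (funext fun v => ?_)
    rw [← Matrix.mulVec_mulVec]
    ext i
    fin_cases i <;>
      simp [modelB, modelS, modelT, Matrix.mulVec, dotProduct, Fin.sum_univ_succ] <;> field_simp <;>
      ring
  | _ + 6 => simp [modelB, modelS, modelT]

end Model

section Charpoly

variable {K : Type*} [Field K] {d : ℕ} {l g : K} {f : K[X]}

theorem IsCofactor.eq_sum (hf : IsCofactor (d + 1) l g f) :
    f = ∑ i ∈ Finset.range d, C (f.coeff i) * X ^ i + X ^ d := by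
  have hdeg : f.natDegree = d := Nat.succ_injective hf.natDegree_eq
  conv_lhs => rw [hf.monic.as_sum, hdeg, add_comm]

theorem IsCofactor.coeff_zero_eq (hf : IsCofactor (d + 1) l g f) (hl : l ≠ 0) :
    f.coeff 0 = (-1) ^ d * g ^ rootDegree (d + 1) / l := by
  rw [eq_div_iff hl, mul_comm, hf.mul_coeff_zero, Nat.succ_injective hf.natDegree_eq]

theorem IsCofactor.charpoly_modelB_one (hf : IsCofactor 1 l g f) :
    (modelB 1 l g f).charpoly = (X - C l) * f := by
  have hf1 : f = 1 := by simpa using hf.eq_sum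
  have hgl : g = l := by simpa [hf1, rootDegree] using hf.mul_coeff_zero.symm
  simp [modelB, Matrix.charpoly, hf1, hgl]

theorem IsCofactor.charpoly_modelB_two (hf : IsCofactor 2 l g f) (hl : l ≠ 0) :
    (modelB 2 l g f).charpoly = (X - C l) * f := by
  have h0 : C (f.coeff 0) = -C (g / l) := by
    rw [hf.coeff_zero_eq hl, ← C_neg]
    simp [rootDegree, neg_div]
  conv_rhs => rw [hf.eq_sum]
  simp [modelB, Matrix.charpoly, Matrix.det_succ_row_zero, Fin.sum_univ_succ, Fin.succAbove,
    -map_mul, -map_add, -map_sub, -map_neg, -map_inv₀, -map_div₀]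
  linear_combination (C l - X) * h0

theorem IsCofactor.charpoly_modelB_three (hf : IsCofactor 3 l g f) (hl : l ≠ 0) (hg : g ≠ 0) :
    (modelB 3 l g f).charpoly = (X - C l) * f := by
  have h0 : C (f.coeff 0) = -(C (g ^ 2 / l) * C (-g⁻¹)) := by
    rw [hf.coeff_zero_eq hl, ← C_mul, ← C_neg]
    congr 1
    simp [rootDegree]
    field_simp
  conv_rhs => rw [hf.eq_sum]
  simp [modelB, Matrix.charpoly, Matrix.det_succ_row_zero, Fin.sum_univ_succ, Fin.succAbove,
    Finset.sum_range_succ, -map_mul, -map_add, -map_sub, -map_neg, -map_inv₀, -map_div₀,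
    C_neg (a := f.coeff 1)]
  linear_combination (C l - X) * h0

theorem IsCofactor.charpoly_modelB_four (hf : IsCofactor 4 l g f) (hl : l ≠ 0) (hg : g ≠ 0) :
    (modelB 4 l g f).charpoly = (X - C l) * f := by
  have h0 : C (f.coeff 0) = -(C (-g ^ 3 / l) * C (-g⁻¹)) := by
    rw [hf.coeff_zero_eq hl, ← C_mul, ← C_neg]
    congr 1
    simp [rootDegree]
    field_simp
  conv_rhs => rw [hf.eq_sum]
  simp [modelB, Matrix.charpoly, Matrix.det_succ_row_zero, Fin.sum_univ_succ, Fin.succAbove,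
    Finset.sum_range_succ, -map_mul, -map_add, -map_sub, -map_neg, -map_inv₀, -map_div₀,
    C_neg (a := f.coeff 1), C_neg (a := f.coeff 2)]
  linear_combination (C l - X) * h0

theorem IsCofactor.charpoly_modelB_five (hf : IsCofactor 5 l g f) (hl : l ≠ 0) (hg : g ≠ 0) :
    (modelB 5 l g f).charpoly = (X - C l) * f := by
  have h0 : C (f.coeff 0) = -(C (g ^ 6 / l) * C (-g⁻¹)) := by
    rw [hf.coeff_zero_eq hl, ← C_mul, ← C_neg]
    congr 1
    simp [rootDegree]
    field_simp
  have h1 : C (f.coeff 1) = -(C (g ^ 6 / l) * C (-(l * f.coeff 1) / g ^ 6)) := by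
    rw [← C_mul, ← C_neg]
    congr 1
    field_simp
  conv_rhs => rw [hf.eq_sum]
  simp [modelB, Matrix.charpoly, Matrix.det_succ_row_zero, Fin.sum_univ_succ, Fin.succAbove,
    Finset.sum_range_succ, -map_mul, -map_add, -map_sub, -map_neg, -map_inv₀, -map_div₀,
    C_neg (a := f.coeff 2), C_neg (a := f.coeff 3)]
  linear_combination (C l - X) * (h0 + X * h1)

theorem IsCofactor.charpoly_modelB (hf : IsCofactor d l g f) (hd : d ≤ 5) (hl : l ≠ 0)
    (hg : g ≠ 0) : (modelB d l g f).charpoly = (X - C l) * f := by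
  match d, hf, hd with
  | 0, hf, _ => exact absurd hf.natDegree_eq (Nat.succ_ne_zero _)
  | 1, hf, _ => exact hf.charpoly_modelB_one
  | 2, hf, _ => exact hf.charpoly_modelB_two hl
  | 3, hf, _ => exact hf.charpoly_modelB_three hl hg
  | 4, hf, _ => exact hf.charpoly_modelB_four hl hg
  | 5, hf, _ => exact hf.charpoly_modelB_five hl hg

end Charpoly

section NormalForm

variable {K : Type*} [Field K]

theorem exists_monic_natDegree_eq_coeff_eq {n : ℕ} (q : Fin n → K) :
    ∃ f : K[X], f.Monic ∧ f.natDegree = n ∧ ∀ i : Fin n, f.coeff i = q i := by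
  classical
  have hdeg : (ofFn n q).degree < (n : WithBot ℕ) := ofFn_degree_lt q
  refine ⟨X ^ n + ofFn n q, monic_X_pow_add hdeg, ?_, fun i => ?_⟩
  · rw [natDegree_add_eq_left_of_degree_lt (by rwa [degree_X_pow]), natDegree_X_pow]
  · rw [coeff_add, coeff_X_pow, if_neg i.is_lt.ne, zero_add, ofFn_coeff_eq_val_of_lt q i.is_lt]

theorem exists_isCofactor_coeff_eq {n : ℕ} {l g : K} (q : Fin (n + 1) → K)
    (hq : l * q 0 = (-1) ^ (n + 1) * g ^ rootDegree (n + 2)) :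
    ∃ f : K[X], IsCofactor (n + 2) l g f ∧ ∀ i : Fin (n + 1), f.coeff i = q i := by
  obtain ⟨f, hf, hdeg, hcoeff⟩ := exists_monic_natDegree_eq_coeff_eq q
  exact ⟨f, ⟨hf, by rw [hdeg], by rw [hdeg, ← hq, ← hcoeff 0, Fin.val_zero]⟩, hcoeff⟩

variable {c l : K}

theorem exists_eq_modelS_eq_modelT_one {S T : Matrix (Fin 1) (Fin 1) K} {x : K} (hc : c ≠ 0)
    (hl : l ≠ 0) (hS : S = !![l * x]) (hT : T = !![x]) (hS2 : S * S = c • 1)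
    (hT3 : T * (T * T) = c • 1) :
    ∃ g f, g ≠ 0 ∧ c = modelScalar 1 g ∧ IsCofactor 1 l g f ∧ S = modelS 1 l g f ∧
      T = modelT 1 l g f := by
  subst hS hT
  have hSx : l * x * (l * x) = c := by simpa [Matrix.mul_apply] using congrFun₂ hS2 0 0
  have hTx : x * (x * x) = c := by simpa [Matrix.mul_apply] using congrFun₂ hT3 0 0
  have hx : x = l ^ 2 := by
    have hx0 : x ≠ 0 := by
      rintro rfl
      simp [hc.symm] at hTx
    apply mul_right_cancel₀ (mul_ne_zero hx0 hx0)
    linear_combination hTx - hSx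
  refine ⟨l, 1, hl, ?_, ⟨monic_one, ?_, ?_⟩, ?_, ?_⟩
  · simp [← hTx, hx, modelScalar]
    ring
  · simp
  · simp [rootDegree]
  · simp [hx, modelS, pow_succ']
  · simp [hx, modelT]

theorem exists_eq_modelS_eq_modelT_two {S T : Matrix (Fin 2) (Fin 2) K} {x₀ x₁ : K} (hc : c ≠ 0)
    (hl : l ≠ 0) (hS : S = !![0, c / l; l, 0]) (hT : T = !![0, x₀; 1, x₁])
    (hT3 : T * (T * T) = c • 1) :
    ∃ g f, g ≠ 0 ∧ c = modelScalar 2 g ∧ IsCofactor 2 l g f ∧ S = modelS 2 l g f ∧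
      T = modelT 2 l g f := by
  subst hS hT
  have h0 : x₀ * x₁ = c := by simpa [Matrix.mul_apply] using congrFun₂ hT3 0 0
  have h1 : x₀ + x₁ * x₁ = 0 := by simpa [Matrix.mul_apply] using congrFun₂ hT3 1 0
  obtain rfl : x₀ = -x₁ ^ 2 := by linear_combination h1
  obtain rfl : c = -x₁ ^ 3 := by linear_combination -h0
  have hx : x₁ ≠ 0 := by
    rintro rfl
    simp at hc
  obtain ⟨f, hf, -⟩ := exists_isCofactor_coeff_eq (l := l) (g := x₁) ![-x₁ / l]
    (by simp [rootDegree]; field_simp)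
  exact ⟨x₁, f, hx, rfl, hf, by simp [modelS], by simp [modelT]⟩

theorem exists_eq_modelS_eq_modelT_three {S T : Matrix (Fin 3) (Fin 3) K} {z₀ z₁ z₂ : K}
    (hc : c ≠ 0) (hl : l ≠ 0) (hS : S = !![0, c / l, z₀; l, 0, z₁; 0, 0, z₂])
    (hT : T = !![0, 0, c; 1, 0, 0; 0, 1, 0]) (hS2 : S * S = c • 1) :
    ∃ g f, g ≠ 0 ∧ c = modelScalar 3 g ∧ IsCofactor 3 l g f ∧ S = modelS 3 l g f ∧
      T = modelT 3 l g f := by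
  subst hS hT
  have h1 : l * z₀ + z₁ * z₂ = 0 := by
    simpa [Matrix.mul_apply, Fin.sum_univ_succ] using congrFun₂ hS2 1 2
  have h2 : z₂ * z₂ = c := by simpa [Matrix.mul_apply, Fin.sum_univ_succ] using congrFun₂ hS2 2 2
  obtain rfl : z₀ = -z₁ * z₂ / l := by
    field_simp
    linear_combination h1
  obtain rfl : c = z₂ ^ 2 := by linear_combination -h2
  have hz : z₂ ≠ 0 := by
    rintro rfl
    simp at hc
  obtain ⟨f, hf, hcoeff⟩ := exists_isCofactor_coeff_eq (l := l) (g := -z₂)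
    ![-z₂ / l, z₁ / (l * z₂)] (by simp [rootDegree]; field_simp)
  have hcoeff1 : f.coeff 1 = z₁ / (l * z₂) := hcoeff 1
  refine ⟨-z₂, f, neg_ne_zero.2 hz, by simp [modelScalar], hf, ?_, by simp [modelT]⟩
  simp [modelS, hcoeff1]
  constructor <;> field_simp

theorem exists_eq_modelS_eq_modelT_four {S T : Matrix (Fin 4) (Fin 4) K} {x₀ x₁ x₂ x₃ : K}
    (hc : c ≠ 0) (hl : l ≠ 0)
    (hS : S = !![0, c / l, 0, 0; l, 0, 0, 0; 0, 0, 0, 1; 0, 0, c, 0])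
    (hT : T = !![0, 0, c, x₀; 1, 0, 0, x₁; 0, 1, 0, x₂; 0, 0, 0, x₃])
    (hT3 : T * (T * T) = c • 1) :
    ∃ g f, g ≠ 0 ∧ c = modelScalar 4 g ∧ IsCofactor 4 l g f ∧ S = modelS 4 l g f ∧
      T = modelT 4 l g f := by
  subst hS hT
  have h2 : x₀ + x₁ * x₃ + x₂ * (x₃ * x₃) = 0 := by
    simpa [Matrix.mul_apply, Fin.sum_univ_succ] using congrFun₂ hT3 2 3
  have h3 : x₃ * (x₃ * x₃) = c := by
    simpa [Matrix.mul_apply, Fin.sum_univ_succ] using congrFun₂ hT3 3 3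
  obtain ⟨g, rfl⟩ : ∃ g, x₃ = -g := ⟨-x₃, (neg_neg _).symm⟩
  obtain rfl : x₀ = x₁ * g - x₂ * g ^ 2 := by linear_combination h2
  obtain rfl : c = -g ^ 3 := by linear_combination -h3
  have hg : g ≠ 0 := by
    rintro rfl
    simp at hc
  obtain ⟨f, hf, hcoeff⟩ := exists_isCofactor_coeff_eq (l := l) (g := g)
    ![-g ^ 2 / l, g ^ 2 * x₂ / l, g * x₂ - x₁] (by simp [rootDegree]; field_simp)
  have hcoeff1 : f.coeff 1 = g ^ 2 * x₂ / l := hcoeff 1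
  have hcoeff2 : f.coeff 2 = g * x₂ - x₁ := hcoeff 2
  have hx₀ : -(g * f.coeff 2) = x₁ * g - x₂ * g ^ 2 := by
    rw [hcoeff2]
    ring
  have hx₁ : l * f.coeff 1 / g - f.coeff 2 = x₁ := by
    rw [hcoeff1, hcoeff2]
    field_simp
    ring
  have hx₂ : l * f.coeff 1 / g ^ 2 = x₂ := by
    rw [hcoeff1]
    field_simp
  exact ⟨g, f, hg, rfl, hf, rfl, by simp [modelT, hx₀, hx₁, hx₂]⟩

theorem exists_isCofactor_five {g : K} (hl : l ≠ 0) (hg : g ≠ 0) (a b e : K) :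
    ∃ f : K[X], IsCofactor 5 l g f ∧ g - l * f.coeff 1 / g ^ 3 - f.coeff 3 = a ∧
      f.coeff 1 - g * f.coeff 2 + g ^ 3 / l * f.coeff 3 - g ^ 4 / l = b ∧
      l * f.coeff 1 / g ^ 2 - g ^ 2 = e := by
  obtain ⟨f, hf, hcoeff⟩ := exists_isCofactor_coeff_eq (l := l) (g := g)
    ![g ^ 5 / l, g ^ 2 * (e + g ^ 2) / l,
      g * (e + g ^ 2) / l - b / g - g ^ 2 * (a + (e + g ^ 2) / g) / l,
      g - (e + g ^ 2) / g - a] (by simp [rootDegree]; field_simp)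
  have hcoeff1 : f.coeff 1 = g ^ 2 * (e + g ^ 2) / l := hcoeff 1
  have hcoeff2 : f.coeff 2 =
      g * (e + g ^ 2) / l - b / g - g ^ 2 * (a + (e + g ^ 2) / g) / l := hcoeff 2
  have hcoeff3 : f.coeff 3 = g - (e + g ^ 2) / g - a := hcoeff 3
  have ha : g - l * f.coeff 1 / g ^ 3 - f.coeff 3 = a := by
    rw [hcoeff1, hcoeff3]
    field_simp
    ring
  have hb : f.coeff 1 - g * f.coeff 2 + g ^ 3 / l * f.coeff 3 - g ^ 4 / l = b := by
    rw [hcoeff1, hcoeff2, hcoeff3]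
    field_simp
    ring
  have he : l * f.coeff 1 / g ^ 2 - g ^ 2 = e := by
    rw [hcoeff1]
    field_simp
    ring
  exact ⟨f, hf, ha, hb, he⟩

theorem exists_eq_neg_sq_eq_cube {x z : K} (hx : x ≠ 0) (hzx : z ^ 2 = -x ^ 3) :
    ∃ g, g ≠ 0 ∧ x = -g ^ 2 ∧ z = g ^ 3 := by
  have hz : z ≠ 0 := by
    rintro rfl
    simp [hx] at hzx
  refine ⟨-z / x, div_ne_zero (neg_ne_zero.2 hz) hx, ?_, ?_⟩
  · field_simp
    linear_combination hzx
  · field_simp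
    linear_combination hzx

theorem exists_eq_modelS_eq_modelT_five {S T : Matrix (Fin 5) (Fin 5) K}
    {x₀ x₁ x₂ x₃ x₄ z₀ z₁ z₂ z₃ z₄ : K} (hc : c ≠ 0) (hl : l ≠ 0)
    (hS : S = !![0, c / l, 0, 0, z₀; l, 0, 0, 0, z₁; 0, 0, 0, 1, z₂; 0, 0, c, 0, z₃;
      0, 0, 0, 0, z₄])
    (hT : T = !![0, 0, c, 0, x₀; 1, 0, 0, 0, x₁; 0, 1, 0, 0, x₂; 0, 0, 0, 0, x₃; 0, 0, 0, 1, x₄])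
    (hS2 : S * S = c • 1) (hT3 : T * (T * T) = c • 1) :
    ∃ g f, g ≠ 0 ∧ c = modelScalar 5 g ∧ IsCofactor 5 l g f ∧ S = modelS 5 l g f ∧
      T = modelT 5 l g f := by
  subst hS hT
  have hS1 : l * z₀ + z₁ * z₄ = 0 := by
    simpa [Matrix.mul_apply, Fin.sum_univ_succ] using congrFun₂ hS2 1 4
  have hS2' : z₃ + z₂ * z₄ = 0 := by
    simpa [Matrix.mul_apply, Fin.sum_univ_succ] using congrFun₂ hS2 2 4
  have hS4 : z₄ * z₄ = c := by
    simpa [Matrix.mul_apply, Fin.sum_univ_succ] using congrFun₂ hS2 4 4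
  have hT1 : x₀ + x₁ * x₄ = 0 := by
    simpa [Matrix.mul_apply, Fin.sum_univ_succ] using congrFun₂ hT3 1 3
  have hT2 : x₁ + x₂ * x₄ = 0 := by
    simpa [Matrix.mul_apply, Fin.sum_univ_succ] using congrFun₂ hT3 2 3
  have hT3' : x₃ * x₄ = c := by
    simpa [Matrix.mul_apply, Fin.sum_univ_succ] using congrFun₂ hT3 3 3
  have hT4 : x₃ + x₄ * x₄ = 0 := by
    simpa [Matrix.mul_apply, Fin.sum_univ_succ] using congrFun₂ hT3 4 3
  obtain ⟨g, hg, rfl, rfl⟩ : ∃ g, g ≠ 0 ∧ x₄ = -g ^ 2 ∧ z₄ = g ^ 3 :=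
    exists_eq_neg_sq_eq_cube (right_ne_zero_of_mul (hT3' ▸ hc))
      (by linear_combination x₄ * hT4 - hT3' + hS4)
  obtain rfl : c = g ^ 6 := by linear_combination -hS4
  obtain rfl : x₃ = -g ^ 4 := by linear_combination hT4
  obtain rfl : x₁ = g ^ 2 * x₂ := by linear_combination hT2
  obtain rfl : x₀ = g ^ 4 * x₂ := by linear_combination hT1
  obtain rfl : z₃ = -g ^ 3 * z₂ := by linear_combination hS2'
  obtain ⟨b, rfl⟩ : ∃ b, z₁ = l * b := ⟨z₁ / l, by field_simp⟩
  obtain rfl : z₀ = -g ^ 3 * b := mul_left_cancel₀ hl (by linear_combination hS1)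
  obtain ⟨f, hf, ha, hb, he⟩ := exists_isCofactor_five hl hg x₂ b z₂
  exact ⟨g, f, hg, rfl, hf, by simp [modelS, hb, he], by simp [modelT, ha]⟩

end NormalForm

section Chain

variable {K V : Type*} [Field K] [AddCommGroup V] [Module K V]

theorem toMatrix_eq_of_apply {ι : Type*} [Fintype ι] [DecidableEq ι] (b : Module.Basis ι K V)
    {f : Module.End K V} {M : Matrix ι ι K} (h : ∀ j, f (b j) = ∑ i, M i j • b i) :
    LinearMap.toMatrix b b f = M := by
  rw [← LinearMap.toMatrix_toLin b b M]
  exact congrArg _ (b.ext fun j => (h j).trans (Matrix.toLin_self b b M j).symm)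

theorem toMatrix_eq_of_apply_castSucc {n : ℕ} (b : Module.Basis (Fin (n + 1)) K V)
    {f : Module.End K V} {M : Matrix (Fin (n + 1)) (Fin (n + 1)) K}
    (h : ∀ j : Fin n, f (b j.castSucc) = ∑ i, M i j.castSucc • b i)
    (hlast : ∀ i, M i (Fin.last n) = b.repr (f (b (Fin.last n))) i) :
    LinearMap.toMatrix b b f = M := by
  refine toMatrix_eq_of_apply b (Fin.lastCases ?_ h)
  simp only [hlast, b.sum_repr]

/-- The vectors `u`, `T u`, `T² u`, `w`, `T w`, where `w` is chosen such that `S w = T² u` when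
`S² = c`. The first `d` of them form a basis of a simple module of dimension `d ≤ 5`. -/
def chain (c : K) (S T : Module.End K V) (u : V) : ℕ → V
  | 0 => u
  | 1 => T u
  | 2 => T (T u)
  | 3 => c⁻¹ • S (T (T u))
  | _ => T (c⁻¹ • S (T (T u)))

namespace IsSimplePair

variable {c l : K} {S T : Module.End K V} {u : V} {d : ℕ}

theorem apply_S_chain_one (h : IsSimplePair c S T) (hl : l ≠ 0) (hu : S u = l • T u) :
    S (chain c S T u 1) = (c / l) • chain c S T u 0 :=
  h.apply_S_apply_T hl hu

theorem apply_S_chain_two (h : IsSimplePair c S T) : S (chain c S T u 2) = c • chain c S T u 3 :=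
  (smul_inv_smul₀ h.ne_zero _).symm

theorem apply_S_chain_three (h : IsSimplePair c S T) : S (chain c S T u 3) = chain c S T u 2 := by
  simp only [chain, map_smul, h.sq, inv_smul_smul₀ h.ne_zero]

theorem apply_T_chain_two (h : IsSimplePair c S T) : T (chain c S T u 2) = c • chain c S T u 0 :=
  h.cube u

theorem finrank_le_of_chain_mem_span (h : IsSimplePair c S T) (hl : l ≠ 0) (hu0 : u ≠ 0)
    (hu : S u = l • T u) (hd : d ≤ 4)
    (hmem : chain c S T u d ∈ Submodule.span K (Set.range fun i : Fin d => chain c S T u i)) :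
    Module.finrank K V ≤ d := by
  set N := Submodule.span K (Set.range fun i : Fin d => chain c S T u i)
  have mem {j : ℕ} (hj : j ≤ d) : chain c S T u j ∈ N :=
    hj.lt_or_eq.elim (fun hlt => Submodule.subset_span ⟨⟨j, hlt⟩, rfl⟩) (fun heq => heq ▸ hmem)
  have hd0 : 0 < d := by
    refine Nat.pos_of_ne_zero ?_
    rintro rfl
    exact hu0 (by simpa [N, chain] using hmem)
  refine h.finrank_le_of_forall_mem_span (v := fun i : Fin d => chain c S T u i) ⟨0, hd0⟩ hu0 ?_ ?_
  · rintro ⟨j, hj⟩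
    match j, hj with
    | 0, hj => exact (show S (chain c S T u 0) = _ from hu) ▸ N.smul_mem _ (mem hj)
    | 1, _ => exact h.apply_S_chain_one hl hu ▸ N.smul_mem _ (mem hd0.le)
    | 2, hj => exact h.apply_S_chain_two ▸ N.smul_mem _ (mem hj)
    | 3, hj => exact h.apply_S_chain_three ▸ mem (Nat.le_of_lt (Nat.lt_of_succ_lt hj))
    | _ + 4, hj => omega
  · rintro ⟨j, hj⟩
    match j, hj with
    | 0, hj | 1, hj | 3, hj => exact mem hj
    | 2, _ => exact h.apply_T_chain_two ▸ N.smul_mem _ (mem hd0.le)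
    | _ + 4, hj => omega

theorem linearIndependent_chain (h : IsSimplePair c S T) (hl : l ≠ 0) (hu0 : u ≠ 0)
    (hu : S u = l • T u) (hd : d ≤ Module.finrank K V) (hd5 : d ≤ 5) :
    LinearIndependent K fun i : Fin d => chain c S T u i := by
  induction d with
  | zero => exact linearIndependent_empty_type
  | succ d ih =>
    rw [linearIndependent_finSucc']
    refine ⟨ih (by omega) (by omega), fun hmem => ?_⟩
    have := h.finrank_le_of_chain_mem_span hl hu0 hu (by omega) hmem
    omega

theorem exists_basis_coe_eq_chain (h : IsSimplePair c S T) (hl : l ≠ 0) (hu0 : u ≠ 0)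
    (hu : S u = l • T u) (hd : Module.finrank K V = d) (hd1 : 1 ≤ d) (hd5 : d ≤ 5) :
    ∃ b : Module.Basis (Fin d) K V, ∀ i, b i = chain c S T u i := by
  have : Nonempty (Fin d) := ⟨⟨0, hd1⟩⟩
  refine ⟨basisOfLinearIndependentOfCardEqFinrank (h.linearIndependent_chain hl hu0 hu hd.ge hd5)
    (by rw [Fintype.card_fin, hd]), fun i => ?_⟩
  rw [coe_basisOfLinearIndependentOfCardEqFinrank]

theorem toMatrix_mul_toMatrix (h : IsSimplePair c S T) (b : Module.Basis (Fin d) K V) :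
    LinearMap.toMatrix b b S * LinearMap.toMatrix b b S = c • 1 := by
  rw [← LinearMap.toMatrix_mul, show S * S = c • 1 from LinearMap.ext h.sq, map_smul,
    LinearMap.toMatrix_one]

theorem toMatrix_mul_toMatrix_mul_toMatrix (h : IsSimplePair c S T)
    (b : Module.Basis (Fin d) K V) :
    LinearMap.toMatrix b b T * (LinearMap.toMatrix b b T * LinearMap.toMatrix b b T) = c • 1 := by
  rw [← LinearMap.toMatrix_mul, ← LinearMap.toMatrix_mul,
    show T * (T * T) = c • 1 from LinearMap.ext h.cube, map_smul, LinearMap.toMatrix_one]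

theorem exists_toMatrix_eq_of_coe_eq_chain_one (h : IsSimplePair c S T) (hl : l ≠ 0)
    (hu : S u = l • T u) {b : Module.Basis (Fin 1) K V} (hb : ∀ i, b i = chain c S T u i) :
    ∃ (g : K) (f : K[X]), g ≠ 0 ∧ c = modelScalar 1 g ∧ IsCofactor 1 l g f ∧
      LinearMap.toMatrix b b S = modelS 1 l g f ∧ LinearMap.toMatrix b b T = modelT 1 l g f := by
  have hS₀ : S (chain c S T u 0) = l • chain c S T u 1 := hu
  have hT₀ : T (chain c S T u 0) = chain c S T u 1 := rfl
  have hT : LinearMap.toMatrix b b T = !![b.repr (T (b 0)) 0] :=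
    toMatrix_eq_of_apply_castSucc b (fun j => j.elim0) (fun i => by fin_cases i; rfl)
  refine exists_eq_modelS_eq_modelT_one h.ne_zero hl (toMatrix_eq_of_apply_castSucc b
    (fun j => j.elim0) (fun i => ?_)) hT (h.toMatrix_mul_toMatrix b)
    (h.toMatrix_mul_toMatrix_mul_toMatrix b)
  fin_cases i
  simp [hb, hS₀, hT₀]

theorem exists_toMatrix_eq_of_coe_eq_chain_two (h : IsSimplePair c S T) (hl : l ≠ 0)
    (hu : S u = l • T u) {b : Module.Basis (Fin 2) K V} (hb : ∀ i, b i = chain c S T u i) :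
    ∃ (g : K) (f : K[X]), g ≠ 0 ∧ c = modelScalar 2 g ∧ IsCofactor 2 l g f ∧
      LinearMap.toMatrix b b S = modelS 2 l g f ∧ LinearMap.toMatrix b b T = modelT 2 l g f := by
  have hS₀ : S (chain c S T u 0) = l • chain c S T u 1 := hu
  have hT₀ : T (chain c S T u 0) = chain c S T u 1 := rfl
  exact exists_eq_modelS_eq_modelT_two h.ne_zero hl
    (toMatrix_eq_of_apply b
      fun j => by fin_cases j <;> simp [hb, hS₀, h.apply_S_chain_one hl hu])
    (toMatrix_eq_of_apply_castSucc b (fun j => by fin_cases j; simp [hb, hT₀])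
      (fun i => by fin_cases i <;> rfl))
    (h.toMatrix_mul_toMatrix_mul_toMatrix b)

theorem exists_toMatrix_eq_of_coe_eq_chain_three (h : IsSimplePair c S T) (hl : l ≠ 0)
    (hu : S u = l • T u) {b : Module.Basis (Fin 3) K V} (hb : ∀ i, b i = chain c S T u i) :
    ∃ (g : K) (f : K[X]), g ≠ 0 ∧ c = modelScalar 3 g ∧ IsCofactor 3 l g f ∧
      LinearMap.toMatrix b b S = modelS 3 l g f ∧ LinearMap.toMatrix b b T = modelT 3 l g f := by
  have hS₀ : S (chain c S T u 0) = l • chain c S T u 1 := hu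
  have hT₀ : T (chain c S T u 0) = chain c S T u 1 := rfl
  have hT₁ : T (chain c S T u 1) = chain c S T u 2 := rfl
  exact exists_eq_modelS_eq_modelT_three h.ne_zero hl
    (toMatrix_eq_of_apply_castSucc b
      (fun j => by
        fin_cases j <;> simp [Fin.sum_univ_succ, hb, hS₀, h.apply_S_chain_one hl hu])
      (fun i => by fin_cases i <;> rfl))
    (toMatrix_eq_of_apply b
      fun j => by fin_cases j <;> simp [Fin.sum_univ_succ, hb, hT₀, hT₁, h.apply_T_chain_two])
    (h.toMatrix_mul_toMatrix b)

theorem exists_toMatrix_eq_of_coe_eq_chain_four (h : IsSimplePair c S T) (hl : l ≠ 0)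
    (hu : S u = l • T u) {b : Module.Basis (Fin 4) K V} (hb : ∀ i, b i = chain c S T u i) :
    ∃ (g : K) (f : K[X]), g ≠ 0 ∧ c = modelScalar 4 g ∧ IsCofactor 4 l g f ∧
      LinearMap.toMatrix b b S = modelS 4 l g f ∧ LinearMap.toMatrix b b T = modelT 4 l g f := by
  have hS₀ : S (chain c S T u 0) = l • chain c S T u 1 := hu
  have hT₀ : T (chain c S T u 0) = chain c S T u 1 := rfl
  have hT₁ : T (chain c S T u 1) = chain c S T u 2 := rfl
  exact exists_eq_modelS_eq_modelT_four h.ne_zero hl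
    (toMatrix_eq_of_apply b
      fun j => by fin_cases j <;> simp [Fin.sum_univ_succ, hb, hS₀, h.apply_S_chain_one hl hu,
        h.apply_S_chain_two, h.apply_S_chain_three])
    (toMatrix_eq_of_apply_castSucc b
      (fun j => by fin_cases j <;> simp [Fin.sum_univ_succ, hb, hT₀, hT₁, h.apply_T_chain_two])
      (fun i => by fin_cases i <;> rfl))
    (h.toMatrix_mul_toMatrix_mul_toMatrix b)

theorem exists_toMatrix_eq_of_coe_eq_chain_five (h : IsSimplePair c S T) (hl : l ≠ 0)
    (hu : S u = l • T u) {b : Module.Basis (Fin 5) K V} (hb : ∀ i, b i = chain c S T u i) :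
    ∃ (g : K) (f : K[X]), g ≠ 0 ∧ c = modelScalar 5 g ∧ IsCofactor 5 l g f ∧
      LinearMap.toMatrix b b S = modelS 5 l g f ∧ LinearMap.toMatrix b b T = modelT 5 l g f := by
  have hS₀ : S (chain c S T u 0) = l • chain c S T u 1 := hu
  have hT₀ : T (chain c S T u 0) = chain c S T u 1 := rfl
  have hT₁ : T (chain c S T u 1) = chain c S T u 2 := rfl
  have hT₃ : T (chain c S T u 3) = chain c S T u 4 := rfl
  exact exists_eq_modelS_eq_modelT_five h.ne_zero hl
    (toMatrix_eq_of_apply_castSucc b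
      (fun j => by fin_cases j <;> simp [Fin.sum_univ_succ, hb, hS₀, h.apply_S_chain_one hl hu,
        h.apply_S_chain_two, h.apply_S_chain_three])
      (fun i => by fin_cases i <;> rfl))
    (toMatrix_eq_of_apply_castSucc b
      (fun j => by
        fin_cases j <;> simp [Fin.sum_univ_succ, hb, hT₀, hT₁, h.apply_T_chain_two, hT₃])
      (fun i => by fin_cases i <;> rfl))
    (h.toMatrix_mul_toMatrix b) (h.toMatrix_mul_toMatrix_mul_toMatrix b)

theorem exists_toMatrix_eq_of_coe_eq_chain (h : IsSimplePair c S T) (hl : l ≠ 0)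
    (hu : S u = l • T u) (hd1 : 1 ≤ d) (hd5 : d ≤ 5) {b : Module.Basis (Fin d) K V}
    (hb : ∀ i, b i = chain c S T u i) :
    ∃ (g : K) (f : K[X]), g ≠ 0 ∧ c = modelScalar d g ∧ IsCofactor d l g f ∧
      LinearMap.toMatrix b b S = modelS d l g f ∧ LinearMap.toMatrix b b T = modelT d l g f := by
  match d, b, hd1, hd5 with
  | 1, _, _, _ => exact h.exists_toMatrix_eq_of_coe_eq_chain_one hl hu hb
  | 2, _, _, _ => exact h.exists_toMatrix_eq_of_coe_eq_chain_two hl hu hb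
  | 3, _, _, _ => exact h.exists_toMatrix_eq_of_coe_eq_chain_three hl hu hb
  | 4, _, _, _ => exact h.exists_toMatrix_eq_of_coe_eq_chain_four hl hu hb
  | 5, _, _, _ => exact h.exists_toMatrix_eq_of_coe_eq_chain_five hl hu hb

theorem exists_basis_toMatrix_eq (h : IsSimplePair c S T) (hl : l ≠ 0) (hu0 : u ≠ 0)
    (hu : S u = l • T u) (hd : Module.finrank K V = d) (hd1 : 1 ≤ d) (hd5 : d ≤ 5) :
    ∃ (b : Module.Basis (Fin d) K V) (g : K) (f : K[X]), g ≠ 0 ∧ c = modelScalar d g ∧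
      IsCofactor d l g f ∧ LinearMap.toMatrix b b S = modelS d l g f ∧
      LinearMap.toMatrix b b T = modelT d l g f := by
  obtain ⟨b, hb⟩ := h.exists_basis_coe_eq_chain hl hu0 hu hd hd1 hd5
  exact ⟨b, h.exists_toMatrix_eq_of_coe_eq_chain hl hu hd1 hd5 hb⟩

end IsSimplePair

end Chain

section Parameter

variable {K : Type*} [Field K] {d : ℕ}

theorem exists_perm_of_prod_eq {l m : Fin d → K}
    (h : ∏ i, (X - C (l i)) = ∏ i, (X - C (m i))) : ∃ π : Equiv.Perm (Fin d), m = l ∘ π := by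
  classical
  have hroots (l : Fin d → K) : (∏ i, (X - C (l i))).roots = Finset.univ.val.map l := by
    rw [← roots_multiset_prod_X_sub_C (Finset.univ.val.map l), Multiset.map_map]
    rfl
  have hcard (l : Fin d → K) (a : K) :
      Fintype.card {i // l i = a} = (∏ i, (X - C (l i))).roots.count a := by
    rw [hroots, Multiset.count_map, Fintype.card_subtype, Finset.card_def, Finset.filter_val]
    simp only [eq_comm]
  let e (a : K) : {i // m i = a} ≃ {i // l i = a} :=
    Fintype.equivOfCardEq (by rw [hcard, hcard, h])
  exact ⟨Equiv.ofFiberEquiv e, funext fun i => (Equiv.ofFiberEquiv_map e i).symm⟩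

theorem exists_prod_eq_of_monic [IsAlgClosed K] {f : K[X]} (hf : f.Monic) (hd : f.natDegree = d) :
    ∃ l : Fin d → K, f = ∏ i, (X - C (l i)) := by
  have hs := IsAlgClosed.splits f
  have hcard : f.roots.toList.length = d := by
    rw [Multiset.length_toList, ← hs.natDegree_eq_card_roots, hd]
  subst hcard
  refine ⟨f.roots.toList.get, ?_⟩
  conv_lhs => rw [hs.eq_prod_roots_of_monic hf, ← Multiset.coe_toList f.roots]
  rw [Multiset.map_coe, Multiset.prod_coe, ← List.prod_ofFn]
  congr 1
  apply List.ext_getElem <;> simp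

theorem X_sub_C_mul_P (l : Fin d → K) (r : Fin d) :
    (X - C (l r)) * P l r = ∏ i, (X - C (l i)) :=
  Finset.mul_prod_erase Finset.univ (fun i => X - C (l i)) (Finset.mem_univ r)

theorem P_eq_mul_prod_erase (l : Fin d → K) {r s : Fin d} (h : r ≠ s) :
    P l s = (X - C (l r)) * ∏ i ∈ (Finset.univ.erase s).erase r, (X - C (l i)) :=
  (Finset.mul_prod_erase _ _ (Finset.mem_erase.2 ⟨h, Finset.mem_univ r⟩)).symm

theorem monic_P (l : Fin d → K) (r : Fin d) : (P l r).Monic :=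
  monic_prod_X_sub_C _ _

theorem mul_coeff_zero_P (l : Fin d → K) (r : Fin d) :
    l r * (P l r).coeff 0 = (-1) ^ (P l r).natDegree * ∏ i, l i := by
  have hcoeff : (P l r).coeff 0 = (-1) ^ (P l r).natDegree * ∏ i ∈ Finset.univ.erase r, l i := by
    rw [P, natDegree_finsetProd_X_sub_C_eq_card, coeff_zero_prod, ← Finset.prod_neg]
    exact Finset.prod_congr rfl fun i _ => by simp
  rw [hcoeff, ← Finset.mul_prod_erase _ _ (Finset.mem_univ r), mul_left_comm]

theorem P_comp_perm (l : Fin d → K) (π : Equiv.Perm (Fin d)) (r : Fin d) :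
    P (l ∘ π) r = P l (π r) :=
  Finset.prod_equiv π (by simp) (by simp)

theorem exists_perm_apply {n : ℕ} {r s : Fin (n + 2)} (h : r ≠ s) :
    ∃ π : Equiv.Perm (Fin (n + 2)), π 0 = r ∧ π 1 = s := by
  refine ⟨(Equiv.swap 0 r).trans (Equiv.swap (Equiv.swap 0 r 1) s), ?_, by simp⟩
  rw [Equiv.trans_apply, Equiv.swap_apply_left, Equiv.swap_apply_of_ne_of_ne _ h]
  intro h'
  simpa using congrArg (Equiv.swap 0 r) h'

theorem Q_comp_perm (p : Param K d) (π : Equiv.Perm (Fin d)) (r s : Fin d) :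
    Q (p.1 ∘ π, p.2) r s = Q p (π r) (π s) := by
  match d, p, π, r, s with
  | 0, _, _, _, _ | 1, _, _, _, _ | 2, _, _, _, _ | _ + 6, _, _, _, _ => rfl
  | 3, (l, g), π, r, s =>
    simp only [Q]
    exact Finset.prod_equiv π (by simp) (by simp)
  | 4, (l, g), π, r, s =>
    simp only [Q]
    congr 1
    exact Finset.prod_equiv (π.prodCongr π) (by simp) (by simp)
  | 5, (l, g), π, r, s =>
    simp only [Q]
    congr 1
    exact Finset.prod_equiv π (by simp) (by simp)

/-- The extra parameter in a form uniform in `d`: the distinguished root of degree `rootDegree d`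
of the determinant. -/
def root : {d : ℕ} → Param K d → K
  | 4, (_, g) => g
  | 5, (_, g) => g
  | _, (l, _) => ∏ i, l i

variable {p : Param K d}

theorem root_pow_rootDegree (hp : p ∈ paramSpace K d) : root p ^ rootDegree d = ∏ i, p.1 i := by
  match d, p, hp with
  | 0, _, _ | 1, _, _ | 2, _, _ | 3, _, _ | _ + 6, _, _ => exact pow_one _
  | 4, (_, _), hp | 5, (_, _), hp => exact hp.2

theorem root_ne_zero (hp : p ∈ paramSpace K d) : root p ≠ 0 := by
  refine ne_zero_pow (n := rootDegree d) (by unfold rootDegree; split <;> simp) ?_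
  rw [root_pow_rootDegree hp]
  exact Finset.prod_ne_zero_iff.2 fun i _ => hp.1 i

theorem exists_root_eq {l : Fin d → K} (hl : ∀ i, l i ≠ 0) {g : K}
    (hg : g ^ rootDegree d = ∏ i, l i) : ∃ p ∈ paramSpace K d, p.1 = l ∧ root p = g := by
  match d, l, hl, hg with
  | 0, l, hl, hg | 1, l, hl, hg | 2, l, hl, hg | 3, l, hl, hg | _ + 6, l, hl, hg =>
    exact ⟨(l, 1), ⟨hl, rfl⟩, rfl, hg.symm.trans (pow_one _)⟩
  | 4, l, hl, hg | 5, l, hl, hg => exact ⟨(l, g), ⟨hl, hg⟩, rfl, rfl⟩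

theorem root_comp_perm (p : Param K d) (π : Equiv.Perm (Fin d)) :
    root (p.1 ∘ π, p.2) = root p := by
  match d, p, π with
  | 0, (l, _), π | 1, (l, _), π | 2, (l, _), π | 3, (l, _), π | _ + 6, (l, _), π =>
    exact Equiv.prod_comp π l
  | 4, (_, _), _ | 5, (_, _), _ => rfl

theorem comp_perm_mem_paramSpace (hp : p ∈ paramSpace K d) (π : Equiv.Perm (Fin d)) :
    (p.1 ∘ π, p.2) ∈ paramSpace K d := by
  refine ⟨fun i => hp.1 (π i), ?_⟩
  match d, p, π, hp.2 with
  | 0, _, _, h | 1, _, _, h | 2, _, _, h | 3, _, _, h | _ + 6, _, _, h => exact h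
  | 4, (l, _), π, h | 5, (l, _), π, h => exact h.trans (Equiv.prod_comp π l).symm

theorem isCofactor_P [NeZero d] (hp : p ∈ paramSpace K d) :
    IsCofactor d (p.1 0) (root p) (P p.1 0) where
  monic := monic_P _ _
  natDegree_eq := by
    rw [P, natDegree_finsetProd_X_sub_C_eq_card, Finset.card_erase_add_one (Finset.mem_univ _),
      Finset.card_univ, Fintype.card_fin]
  mul_coeff_zero := by rw [mul_coeff_zero_P, root_pow_rootDegree hp]

theorem eq_of_pow_eq_of_pow_succ_eq {x y : K} {n : ℕ} (hx : x ≠ 0) (h : y ^ n = x ^ n)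
    (h' : y ^ (n + 1) = x ^ (n + 1)) : y = x := by
  rw [pow_succ, pow_succ, h] at h'
  exact mul_left_cancel₀ (pow_ne_zero n hx) h'

variable {V W : Type*} [AddCommGroup V] [Module K V] [AddCommGroup W] [Module K W]
  {ρ : Representation K B3 V} {ρ' : Representation K B3 W} {q : Param K d}

theorem CentralCondition.of_snd_eq (h : CentralCondition ρ p) (hpq : q.2 = p.2) :
    CentralCondition ρ q := by
  obtain ⟨l, g⟩ := p
  obtain ⟨m, g'⟩ := q
  obtain rfl : g' = g := hpq
  match d, l, m, h with
  | 0, _, _, _ | 1, _, _, _ | 2, _, _, _ | 3, _, _, _ | _ + 6, _, _, _ => trivial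
  | 4, _, _, h | 5, _, _, h => exact h

theorem CentralCondition.of_equiv (h : CentralCondition ρ p) (e : ρ.Equiv ρ') :
    CentralCondition ρ' p := by
  have hζ {c : K} (h : ρ ζ = c • 1) : ρ' ζ = c • 1 := by
    rw [← e.conj_apply_self, h, map_smul]
    exact congrArg _ (LinearEquiv.conj_id _)
  match d, p, h with
  | 0, _, _ | 1, _, _ | 2, _, _ | 3, _, _ | _ + 6, _, _ => trivial
  | 4, (_, _), h | 5, (_, _), h => exact hζ h

theorem centralCondition_of_apply_ζ (h : ρ ζ = modelScalar d (root p) • (1 : Module.End K V)) :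
    CentralCondition ρ p := by
  match d, p, h with
  | 0, _, _ | 1, _, _ | 2, _, _ | 3, _, _ | _ + 6, _, _ => trivial
  | 4, (_, _), h | 5, (_, _), h => exact h

variable [FiniteDimensional K V] [FiniteDimensional K W]

theorem HasParam.comp_perm (h : HasParam ρ p) (π : Equiv.Perm (Fin d)) :
    HasParam ρ (p.1 ∘ π, p.2) where
  charpoly_eq := h.charpoly_eq.trans (Equiv.prod_comp π fun i => X - C (p.1 i)).symm
  mem := comp_perm_mem_paramSpace h.mem π
  central := h.central.of_snd_eq rfl

theorem HasParam.of_equiv (h : HasParam ρ p) (e : ρ.Equiv ρ') : HasParam ρ' p where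
  charpoly_eq := by rw [← h.charpoly_eq, ← e.conj_apply_self, LinearEquiv.charpoly_conj]
  mem := h.mem
  central := h.central.of_equiv e

theorem HasParam.finrank_eq (h : HasParam ρ p) : Module.finrank K V = d := by
  rw [← LinearMap.charpoly_natDegree (ρ σ₁), h.charpoly_eq, natDegree_finsetProd_X_sub_C_eq_card,
    Finset.card_univ, Fintype.card_fin]

theorem HasParam.exists_perm (hp : HasParam ρ p) (hq : HasParam ρ q) :
    ∃ π : Equiv.Perm (Fin d), q.1 = p.1 ∘ π :=
  exists_perm_of_prod_eq (hp.charpoly_eq.symm.trans hq.charpoly_eq)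

theorem HasParam.snd_eq [Nontrivial V] (hp : HasParam ρ p) (hq : HasParam ρ q) : q.2 = p.2 := by
  have hprod : ∏ i, q.1 i = ∏ i, p.1 i := by
    obtain ⟨π, hπ⟩ := hp.exists_perm hq
    rw [hπ]
    exact Equiv.prod_comp π p.1
  have hroot : root q ^ rootDegree d = root p ^ rootDegree d := by
    rw [root_pow_rootDegree hp.mem, root_pow_rootDegree hq.mem, hprod]
  have hne := root_ne_zero hp.mem
  have hinj : Function.Injective fun c : K => c • (1 : Module.End K V) :=
    smul_left_injective K one_ne_zero
  obtain ⟨-, ⟨-, hp⟩, hpc⟩ := hp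
  obtain ⟨-, ⟨-, hq⟩, hqc⟩ := hq
  clear hprod
  match d, p, q with
  | 0, _, _ | 1, _, _ | 2, _, _ | 3, _, _ | _ + 6, _, _ => exact Eq.trans hq (Eq.symm hp)
  | 4, (_, _), (_, _) =>
    exact eq_of_pow_eq_of_pow_succ_eq hne hroot (neg_injective (hinj (hqc.symm.trans hpc)))
  | 5, (_, _), (_, _) => exact eq_of_pow_eq_of_pow_succ_eq hne hroot (hinj (hqc.symm.trans hpc))

theorem HasParam.iff_sameOrbit [Nontrivial V] (hp : HasParam ρ p) :
    HasParam ρ q ↔ SameOrbit p q := by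
  constructor
  · intro hq
    obtain ⟨π, hπ⟩ := hp.exists_perm hq
    exact ⟨π, hπ, hp.snd_eq hq⟩
  · rintro ⟨π, h₁, h₂⟩
    obtain rfl : q = (p.1 ∘ π, p.2) := Prod.ext h₁ h₂
    exact hp.comp_perm π

end Parameter

section Excluded

variable {K : Type*} [Field K]

theorem exists_Q_eq_zero_of_isExcluded_four {p : Param K 4} (h : IsExcluded p) :
    ∃ r s, r ≠ s ∧ Q p r s = 0 := by
  match p, h with
  | (l, g), .inl ⟨i, h⟩ =>
    obtain ⟨s, hs⟩ := exists_ne i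
    exact ⟨i, s, hs.symm, by simp [Q, h]⟩
  | (l, g), .inr ⟨i, j, r, s, hd, h⟩ =>
    simp only [List.nodup_cons, List.mem_cons, List.not_mem_nil, or_false, not_or] at hd
    obtain ⟨⟨hij, hir, his⟩, ⟨hjr, hjs⟩, hrs, -⟩ := hd
    refine ⟨i, r, hir, mul_eq_zero_of_right _ ?_⟩
    exact Finset.prod_eq_zero (i := (j, s))
      (by simp [Ne.symm hij, hjr, Ne.symm his, Ne.symm hrs, hjs]) h

theorem exists_Q_eq_zero_of_isExcluded_five {p : Param K 5} (h : IsExcluded p) :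
    ∃ r s, r ≠ s ∧ Q p r s = 0 := by
  match p, h with
  | (l, g), .inl ⟨i, h⟩ =>
    obtain ⟨s, hs⟩ := exists_ne i
    have hi : g ^ 2 + l i * g + l i ^ 2 = 0 := by rw [← h, mul_comm g]
    exact ⟨i, s, hs.symm, by simp [Q, hi]⟩
  | (l, g), .inr ⟨i, j, hij, h⟩ =>
    obtain ⟨s, hs⟩ : (({i, j} : Finset (Fin 5))ᶜ).Nonempty := by
      rw [← Finset.card_pos, Finset.card_compl, Finset.card_pair hij.ne]
      simp
    simp only [Finset.mem_compl, Finset.mem_insert, Finset.mem_singleton, not_or] at hs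
    refine ⟨i, s, Ne.symm hs.1, mul_eq_zero_of_right _ ?_⟩
    exact Finset.prod_eq_zero (i := j) (by simp [hij.ne', Ne.symm hs.2]) (by rw [h, zero_mul])

theorem isExcluded_three_of_Q_eq_zero {p : Param K 3} {r s : Fin 3} (hrs : r ≠ s)
    (h : Q p r s = 0) : IsExcluded p := by
  obtain ⟨k, hk, h⟩ := Finset.prod_eq_zero_iff.1 h
  simp only [Finset.mem_compl, Finset.mem_insert, Finset.mem_singleton, not_or] at hk
  rcases mul_eq_zero.1 h with h | h
  · exact ⟨r, s, k, hrs, Ne.symm hk.1, Ne.symm hk.2, h⟩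
  · exact ⟨s, r, k, hrs.symm, Ne.symm hk.2, Ne.symm hk.1, h⟩

theorem isExcluded_four_of_Q_eq_zero {p : Param K 4} (hp : p ∈ paramSpace K 4) {r s : Fin 4}
    (hrs : r ≠ s) (h : Q p r s = 0) : IsExcluded p := by
  have hg : p.2 ≠ 0 := root_ne_zero hp
  simp only [Q, mul_eq_zero, neg_eq_zero, inv_eq_zero, hg, false_or] at h
  rcases h with (h | h) | h
  · exact Or.inl ⟨r, h⟩
  · exact Or.inl ⟨s, h⟩
  · obtain ⟨⟨k, m⟩, hk, h⟩ := Finset.prod_eq_zero_iff.1 h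
    simp only [Finset.mem_offDiag, Finset.mem_compl, Finset.mem_insert, Finset.mem_singleton,
      not_or] at hk
    obtain ⟨⟨hkr, hks⟩, ⟨hmr, hms⟩, hkm⟩ := hk
    exact Or.inr ⟨r, k, s, m, by simp [hrs, hks, Ne.symm hkr, Ne.symm hmr, hkm, Ne.symm hms], h⟩

theorem isExcluded_five_of_add_mul_eq_zero {p : Param K 5} {i j : Fin 5} (hij : i ≠ j)
    (h : p.2 ^ 2 + p.1 i * p.1 j = 0) : IsExcluded p := by
  rcases lt_or_gt_of_ne hij with hij | hij
  · exact Or.inr ⟨i, j, hij, h⟩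
  · exact Or.inr ⟨j, i, hij, by rwa [mul_comm (p.1 j)]⟩

theorem isExcluded_five_of_Q_eq_zero {p : Param K 5} (hp : p ∈ paramSpace K 5) {r s : Fin 5}
    (h : Q p r s = 0) : IsExcluded p := by
  have hg : p.2 ≠ 0 := root_ne_zero hp
  simp only [Q, mul_eq_zero, inv_eq_zero, pow_eq_zero_iff (show 8 ≠ 0 by simp), hg,
    false_or] at h
  rcases h with (h | h) | h
  · exact Or.inl ⟨r, by linear_combination h⟩
  · exact Or.inl ⟨s, by linear_combination h⟩
  · obtain ⟨k, hk, h⟩ := Finset.prod_eq_zero_iff.1 h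
    simp only [Finset.mem_compl, Finset.mem_insert, Finset.mem_singleton, not_or] at hk
    rcases mul_eq_zero.1 h with h | h
    · exact isExcluded_five_of_add_mul_eq_zero (Ne.symm hk.1) h
    · exact isExcluded_five_of_add_mul_eq_zero (Ne.symm hk.2) h

variable {d : ℕ} {p : Param K d}

theorem exists_Q_eq_zero_of_isExcluded (h : IsExcluded p) : ∃ r s, r ≠ s ∧ Q p r s = 0 := by
  match d, p, h with
  | 2, (l, _), h =>
    refine ⟨0, 1, by decide, ?_⟩
    simp only [IsExcluded, Q] at h ⊢
    linear_combination -h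
  | 3, (l, _), ⟨i, r, s, hir, his, hrs, h⟩ =>
    refine ⟨i, r, hir, ?_⟩
    exact Finset.prod_eq_zero (i := s) (by simp [his.symm, hrs.symm]) (by rw [h, zero_mul])
  | 4, _, h => exact exists_Q_eq_zero_of_isExcluded_four h
  | 5, _, h => exact exists_Q_eq_zero_of_isExcluded_five h

theorem isExcluded_of_Q_eq_zero (hp : p ∈ paramSpace K d) {r s : Fin d} (hrs : r ≠ s)
    (h : Q p r s = 0) : IsExcluded p := by
  match d, p, hp, r, s, h with
  | 0, _, _, r, _, _ => exact r.elim0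
  | 1, _, _, r, s, _ => exact hrs (Subsingleton.elim _ _)
  | 2, (l, _), _, r, s, h =>
    simp only [IsExcluded, Q] at h ⊢
    fin_cases r <;> fin_cases s <;> simp only [Fin.zero_eta, Fin.mk_one, ne_eq,
      not_true_eq_false] at h hrs <;> linear_combination -h
  | 3, _, _, _, _, h => exact isExcluded_three_of_Q_eq_zero hrs h
  | 4, _, hp, _, _, h => exact isExcluded_four_of_Q_eq_zero hp hrs h
  | 5, _, hp, _, _, h => exact isExcluded_five_of_Q_eq_zero hp h
  | _ + 6, _, _, _, _, h => exact absurd h one_ne_zero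

end Excluded

section Identity

open scoped Matrix

variable {K : Type*} [Field K] {l a g : K} {f q : K[X]} {n : ℕ}

theorem IsCofactor.monic_of_mul (hf : IsCofactor (n + 2) l g ((X - C a) * q)) : q.Monic :=
  (monic_X_sub_C a).of_mul_monic_left hf.monic

theorem IsCofactor.natDegree_of_mul (hf : IsCofactor (n + 2) l g ((X - C a) * q)) :
    q.natDegree = n := by
  have h := hf.natDegree_eq
  rw [(monic_X_sub_C a).natDegree_mul hf.monic_of_mul, natDegree_X_sub_C] at h
  lia

theorem IsCofactor.coeff_natDegree_of_mul (hf : IsCofactor (n + 2) l g ((X - C a) * q)) :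
    q.coeff n = 1 := by
  rw [← hf.natDegree_of_mul, hf.monic_of_mul.coeff_natDegree]

theorem IsCofactor.eq_sum_of_mul (hf : IsCofactor (n + 2) l g ((X - C a) * q)) :
    q = ∑ i ∈ Finset.range n, C (q.coeff i) * X ^ i + X ^ n := by
  conv_lhs => rw [hf.monic_of_mul.as_sum, hf.natDegree_of_mul, add_comm]

theorem IsCofactor.coeff_zero_of_mul (hf : IsCofactor (n + 2) l g ((X - C a) * q)) (hl : l ≠ 0)
    (ha : a ≠ 0) : q.coeff 0 = (-1) ^ n * g ^ rootDegree (n + 2) / (l * a) := by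
  have h := hf.mul_coeff_zero
  rw [Nat.succ_injective hf.natDegree_eq, Polynomial.mul_coeff_zero, coeff_sub, coeff_X_zero,
    coeff_C_zero, pow_succ] at h
  rw [eq_div_iff (mul_ne_zero hl ha)]
  linear_combination -h

theorem modelB_five_mulVec (l g : K) (f : K[X]) (v₀ v₁ v₂ v₃ v₄ : K) :
    modelB 5 l g f *ᵥ ![v₀, v₁, v₂, v₃, v₄] =
      ![g ^ 6 / l * v₂ - f.coeff 2 * v₃, l * v₁ + modelB 5 l g f 1 3 * v₃,
        v₄ - l * f.coeff 1 / g ^ 6 * v₃, v₀ - f.coeff 3 * v₃, -(v₃ / g)] := by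
  ext i
  fin_cases i <;> simp [modelB, Matrix.mulVec, dotProduct, Fin.sum_univ_succ] <;> ring

theorem modelS_five_mulVec (l g : K) (f : K[X]) (v₀ v₁ v₂ v₃ v₄ : K) :
    modelS 5 l g f *ᵥ ![v₀, v₁, v₂, v₃, v₄] =
      ![g ^ 6 / l * v₁ + modelS 5 l g f 0 4 * v₄, l * v₀ + modelS 5 l g f 1 4 * v₄,
        v₃ + modelS 5 l g f 2 4 * v₄, g ^ 6 * v₂ + modelS 5 l g f 3 4 * v₄, g ^ 3 * v₄] := by
  ext i
  fin_cases i <;> simp [modelS, Matrix.mulVec, dotProduct, Fin.sum_univ_succ]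

theorem IsCofactor.aeval_modelB_five_mulVec (hf : IsCofactor 5 l g f) (hl : l ≠ 0) (hg : g ≠ 0)
    (v₀ v₁ v₂ v₃ v₄ : K) :
    aeval (modelB 5 l g f) f *ᵥ ![v₀, v₁, v₂, v₃, v₄] =
      ![0, modelB 5 l g f 1 3 * (l ^ 2 * v₀ + g ^ 6 * v₂ + l ^ 3 * v₃ + g ^ 6 / l * v₄) +
        (l ^ 4 + f.coeff 3 * l ^ 3 + f.coeff 2 * l ^ 2 + f.coeff 1 * l + g ^ 5 / l) * v₁,
        0, 0, 0] := by
  have h0 : f.coeff 0 = g ^ 5 / l := by norm_num [hf.coeff_zero_eq hl, rootDegree]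
  conv_lhs => enter [1, 2]; rw [hf.eq_sum]
  simp only [Finset.sum_range_succ, Finset.sum_range_zero, zero_add, h0, map_add, map_mul, aeval_X,
    aeval_C, pow_succ, pow_zero, mul_one, one_mul, Matrix.add_mulVec, ← Matrix.mulVec_mulVec,
    Algebra.algebraMap_eq_smul_one, Matrix.smul_mulVec, Matrix.one_mulVec, modelB_five_mulVec,
    Matrix.smul_cons, Matrix.smul_empty, Matrix.cons_add_cons, Matrix.empty_add_empty, smul_eq_mul,
    Matrix.vecCons_inj, and_true]
  refine ⟨?_, ?_, ?_, ?_, ?_⟩ <;> field_simp <;> ring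

theorem IsCofactor.aeval_modelB_five_mulVec_e₀ (hf : IsCofactor 5 l g ((X - C a) * q))
    (hl : l ≠ 0) (ha : a ≠ 0) (hg : g ≠ 0) :
    aeval (modelB 5 l g ((X - C a) * q)) q *ᵥ ![1, 0, 0, 0, 0] =
      ![a ^ 2 * q.coeff 2, (l + a) * modelB 5 l g ((X - C a) * q) 1 3,
        l * a ^ 2 * q.coeff 1 / g ^ 6, a ^ 2, -a / g] := by
  have h0 : q.coeff 0 = -(g ^ 5 / (l * a)) := by
    norm_num [hf.coeff_zero_of_mul hl ha, rootDegree, neg_div]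
  have h1 : ((X - C a) * q).coeff 1 = _ := coeff_X_sub_C_mul
  have h2 : ((X - C a) * q).coeff 2 = _ := coeff_X_sub_C_mul
  have h3 : ((X - C a) * q).coeff 3 = _ := coeff_X_sub_C_mul
  simp only [zero_add, Nat.reduceAdd, h0, hf.coeff_natDegree_of_mul] at h1 h2 h3
  conv_lhs => enter [1, 2]; rw [hf.eq_sum_of_mul]
  simp only [Finset.sum_range_succ, Finset.sum_range_zero, zero_add, h0, h1, h2, h3,
    map_add, map_mul, aeval_X, aeval_C, pow_succ, pow_zero, mul_one, one_mul, Matrix.add_mulVec,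
    ← Matrix.mulVec_mulVec, Algebra.algebraMap_eq_smul_one, Matrix.smul_mulVec, Matrix.one_mulVec,
    modelB_five_mulVec, Matrix.smul_cons, Matrix.smul_empty, Matrix.cons_add_cons,
    Matrix.empty_add_empty, smul_eq_mul, Matrix.vecCons_inj, and_true]
  refine ⟨?_, ?_, ?_, ?_, ?_⟩ <;> field_simp <;> ring

theorem IsCofactor.aeval_modelB_five_identity (hf : IsCofactor 5 l g ((X - C a) * q)) (hl : l ≠ 0)
    (ha : a ≠ 0) (hg : g ≠ 0) :
    aeval (modelB 5 l g ((X - C a) * q)) ((X - C a) * q) *ᵥ (modelS 5 l g ((X - C a) * q) *ᵥ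
      (aeval (modelB 5 l g ((X - C a) * q)) ((X - C l) * q) *ᵥ ![1, 0, 0, 0, 0])) =
      ![0, (g ^ 8)⁻¹ * (g ^ 2 + l * g + l ^ 2) * (g ^ 2 + a * g + a ^ 2) *
        ((g ^ 6 - g ^ 4 * l * q.coeff 2 + g ^ 2 * l ^ 2 * q.coeff 1 - l ^ 3 * q.coeff 0) *
          (g ^ 6 - g ^ 4 * a * q.coeff 2 + g ^ 2 * a ^ 2 * q.coeff 1 - a ^ 3 * q.coeff 0)) * l,
        0, 0, 0] := by
  have h0 : q.coeff 0 = -(g ^ 5 / (l * a)) := by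
    norm_num [hf.coeff_zero_of_mul hl ha, rootDegree, neg_div]
  have h1 : ((X - C a) * q).coeff 1 = _ := coeff_X_sub_C_mul
  have h2 : ((X - C a) * q).coeff 2 = _ := coeff_X_sub_C_mul
  have h3 : ((X - C a) * q).coeff 3 = _ := coeff_X_sub_C_mul
  simp only [zero_add, Nat.reduceAdd, h0, hf.coeff_natDegree_of_mul] at h1 h2 h3
  rw [map_mul (aeval _) (X - C l), ← Matrix.mulVec_mulVec,
    hf.aeval_modelB_five_mulVec_e₀ hl ha hg]
  simp only [map_sub, aeval_X, aeval_C, Matrix.sub_mulVec, Algebra.algebraMap_eq_smul_one,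
    Matrix.smul_mulVec, Matrix.one_mulVec, modelB_five_mulVec, Matrix.smul_cons, Matrix.smul_empty,
    Matrix.cons_sub_cons, Matrix.empty_sub_empty, smul_eq_mul, modelS_five_mulVec,
    hf.aeval_modelB_five_mulVec hl hg, Matrix.vecCons_inj, and_true, true_and]
  simp [modelB, modelS, h0, h1, h2, h3]
  field_simp
  ring

theorem modelB_four_mulVec (l g : K) (f : K[X]) (v₀ v₁ v₂ v₃ : K) :
    modelB 4 l g f *ᵥ ![v₀, v₁, v₂, v₃] =
      ![-(g ^ 3 / l * v₂) - f.coeff 1 * v₃, l * v₁ + modelB 4 l g f 1 3 * v₃, -(v₃ / g),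
        v₀ - f.coeff 2 * v₃] := by
  ext i
  fin_cases i <;> simp [modelB, Matrix.mulVec, dotProduct, Fin.sum_univ_succ] <;> ring

theorem modelS_four_mulVec (l g : K) (f : K[X]) (v₀ v₁ v₂ v₃ : K) :
    modelS 4 l g f *ᵥ ![v₀, v₁, v₂, v₃] = ![-(g ^ 3 / l * v₁), l * v₀, v₃, -(g ^ 3 * v₂)] := by
  ext i
  fin_cases i <;> simp [modelS, Matrix.mulVec, dotProduct, Fin.sum_univ_succ]
  ring

theorem IsCofactor.aeval_modelB_four_mulVec (hf : IsCofactor 4 l g f) (hl : l ≠ 0) (hg : g ≠ 0)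
    (v₀ v₁ v₂ v₃ : K) :
    aeval (modelB 4 l g f) f *ᵥ ![v₀, v₁, v₂, v₃] =
      ![0, modelB 4 l g f 1 3 * (l * v₀ - g ^ 3 / l * v₂ + l ^ 2 * v₃) +
        (l ^ 3 + f.coeff 2 * l ^ 2 + f.coeff 1 * l - g ^ 2 / l) * v₁, 0, 0] := by
  have h0 : f.coeff 0 = -(g ^ 2 / l) := by norm_num [hf.coeff_zero_eq hl, rootDegree, neg_div]
  conv_lhs => enter [1, 2]; rw [hf.eq_sum]
  simp only [Finset.sum_range_succ, Finset.sum_range_zero, zero_add, h0, map_add, map_mul, aeval_X,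
    aeval_C, pow_succ, pow_zero, mul_one, one_mul, Matrix.add_mulVec, ← Matrix.mulVec_mulVec,
    Algebra.algebraMap_eq_smul_one, Matrix.smul_mulVec, Matrix.one_mulVec, modelB_four_mulVec,
    Matrix.smul_cons, Matrix.smul_empty, Matrix.cons_add_cons, Matrix.empty_add_empty, smul_eq_mul,
    Matrix.vecCons_inj, and_true]
  refine ⟨?_, ?_, ?_, ?_⟩ <;> field_simp <;> ring

theorem IsCofactor.aeval_modelB_four_mulVec_e₀ (hf : IsCofactor 4 l g ((X - C a) * q))
    (hl : l ≠ 0) (ha : a ≠ 0) (hg : g ≠ 0) :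
    aeval (modelB 4 l g ((X - C a) * q)) q *ᵥ ![1, 0, 0, 0] =
      ![a * q.coeff 1, modelB 4 l g ((X - C a) * q) 1 3, -1 / g, a] := by
  have h0 : q.coeff 0 = g ^ 2 / (l * a) := by norm_num [hf.coeff_zero_of_mul hl ha, rootDegree]
  have h1 : ((X - C a) * q).coeff 1 = _ := coeff_X_sub_C_mul
  have h2 : ((X - C a) * q).coeff 2 = _ := coeff_X_sub_C_mul
  simp only [zero_add, Nat.reduceAdd, h0, hf.coeff_natDegree_of_mul] at h1 h2
  conv_lhs => enter [1, 2]; rw [hf.eq_sum_of_mul]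
  simp only [Finset.sum_range_succ, Finset.sum_range_zero, zero_add, h0, h1, h2,
    map_add, map_mul, aeval_X, aeval_C, pow_succ, pow_zero, mul_one, one_mul, Matrix.add_mulVec,
    ← Matrix.mulVec_mulVec, Algebra.algebraMap_eq_smul_one, Matrix.smul_mulVec, Matrix.one_mulVec,
    modelB_four_mulVec, Matrix.smul_cons, Matrix.smul_empty, Matrix.cons_add_cons,
    Matrix.empty_add_empty, smul_eq_mul, Matrix.vecCons_inj, and_true]
  refine ⟨?_, ?_, ?_, ?_⟩ <;> field_simp <;> ring

theorem IsCofactor.aeval_modelB_four_identity (hf : IsCofactor 4 l g ((X - C a) * q)) (hl : l ≠ 0)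
    (ha : a ≠ 0) (hg : g ≠ 0) :
    aeval (modelB 4 l g ((X - C a) * q)) ((X - C a) * q) *ᵥ (modelS 4 l g ((X - C a) * q) *ᵥ
      (aeval (modelB 4 l g ((X - C a) * q)) ((X - C l) * q) *ᵥ ![1, 0, 0, 0])) =
      ![0, -g⁻¹ * (l ^ 2 + g) * (a ^ 2 + g) *
        (g ^ 2 - g * (l + a) * q.coeff 1 + (l ^ 2 + a ^ 2) * q.coeff 0 +
          l * a * (q.coeff 1 ^ 2 - 2 * q.coeff 0)) * l, 0, 0] := by
  have h0 : q.coeff 0 = g ^ 2 / (l * a) := by norm_num [hf.coeff_zero_of_mul hl ha, rootDegree]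
  have h1 : ((X - C a) * q).coeff 1 = _ := coeff_X_sub_C_mul
  have h2 : ((X - C a) * q).coeff 2 = _ := coeff_X_sub_C_mul
  simp only [zero_add, Nat.reduceAdd, h0, hf.coeff_natDegree_of_mul] at h1 h2
  rw [map_mul (aeval _) (X - C l), ← Matrix.mulVec_mulVec, hf.aeval_modelB_four_mulVec_e₀ hl ha hg]
  simp only [map_sub, aeval_X, aeval_C, Matrix.sub_mulVec, Algebra.algebraMap_eq_smul_one,
    Matrix.smul_mulVec, Matrix.one_mulVec, modelB_four_mulVec, Matrix.smul_cons, Matrix.smul_empty,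
    Matrix.cons_sub_cons, Matrix.empty_sub_empty, smul_eq_mul, modelS_four_mulVec,
    hf.aeval_modelB_four_mulVec hl hg, Matrix.vecCons_inj, and_true, true_and]
  simp [modelB, h0, h1, h2]
  field_simp
  ring

theorem modelB_three_mulVec (l g : K) (f : K[X]) (v₀ v₁ v₂ : K) :
    modelB 3 l g f *ᵥ ![v₀, v₁, v₂] =
      ![g ^ 2 / l * v₂ - f.coeff 1 * v₀, l * v₁ - l / g * f.coeff 1 * v₀, -(v₀ / g)] := by
  ext i
  fin_cases i <;> simp [modelB, Matrix.mulVec, dotProduct, Fin.sum_univ_succ] <;> ring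

theorem modelS_three_mulVec (l g : K) (f : K[X]) (v₀ v₁ v₂ : K) :
    modelS 3 l g f *ᵥ ![v₀, v₁, v₂] =
      ![g ^ 2 / l * v₁ - g ^ 2 * f.coeff 1 * v₂, l * v₀ - l * g * f.coeff 1 * v₂, -(g * v₂)] := by
  ext i
  fin_cases i <;> simp [modelS, Matrix.mulVec, dotProduct, Fin.sum_univ_succ] <;> ring

theorem IsCofactor.aeval_modelB_three_mulVec_e₀ (hf : IsCofactor 3 l g ((X - C a) * q))
    (hl : l ≠ 0) (ha : a ≠ 0) (hg : g ≠ 0) :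
    aeval (modelB 3 l g ((X - C a) * q)) q *ᵥ ![1, 0, 0] =
      ![a, l * a / g + 1 / a, -(1 / g)] := by
  have h0 : q.coeff 0 = -(g / (l * a)) := by
    norm_num [hf.coeff_zero_of_mul hl ha, rootDegree, neg_div]
  have h1 : ((X - C a) * q).coeff 1 = _ := coeff_X_sub_C_mul
  simp only [zero_add, h0, hf.coeff_natDegree_of_mul] at h1
  conv_lhs => enter [1, 2]; rw [hf.eq_sum_of_mul]
  simp only [Finset.sum_range_succ, Finset.sum_range_zero, zero_add, h0, h1, map_add,
    aeval_X, aeval_C, pow_succ, pow_zero, mul_one, one_mul, Matrix.add_mulVec,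
    Algebra.algebraMap_eq_smul_one, Matrix.smul_mulVec, Matrix.one_mulVec, modelB_three_mulVec,
    Matrix.smul_cons, Matrix.smul_empty, Matrix.cons_add_cons,
    Matrix.empty_add_empty, smul_eq_mul, Matrix.vecCons_inj, and_true]
  refine ⟨?_, ?_, ?_⟩ <;> field_simp <;> ring

theorem IsCofactor.aeval_modelB_three_identity (hf : IsCofactor 3 l g ((X - C a) * q)) (hl : l ≠ 0)
    (ha : a ≠ 0) (hg : g ≠ 0) :
    aeval (modelB 3 l g ((X - C a) * q)) ((X - C a) * q) *ᵥ (modelS 3 l g ((X - C a) * q) *ᵥ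
      (aeval (modelB 3 l g ((X - C a) * q)) ((X - C l) * q) *ᵥ ![1, 0, 0])) =
      ![0, (l ^ 2 - a * q.coeff 0) * (a ^ 2 - l * q.coeff 0) * l, 0] := by
  have h0 : q.coeff 0 = -(g / (l * a)) := by
    norm_num [hf.coeff_zero_of_mul hl ha, rootDegree, neg_div]
  have h1 : ((X - C a) * q).coeff 1 = _ := coeff_X_sub_C_mul
  have h2 : ((X - C a) * q).coeff 0 = g / l := by norm_num [hf.coeff_zero_eq hl, rootDegree]
  simp only [zero_add, h0, hf.coeff_natDegree_of_mul] at h1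
  rw [map_mul (aeval _) (X - C l), ← Matrix.mulVec_mulVec, hf.aeval_modelB_three_mulVec_e₀ hl ha
    hg]
  conv_lhs => enter [1, 2]; rw [hf.eq_sum]
  simp only [Finset.sum_range_succ, Finset.sum_range_zero, zero_add, h0, h1, h2, pow_succ, pow_zero,
    mul_one, one_mul, map_add, map_mul, Matrix.add_mulVec, ← Matrix.mulVec_mulVec,
    map_sub, aeval_X, aeval_C, Matrix.sub_mulVec, Algebra.algebraMap_eq_smul_one,
    Matrix.smul_mulVec, Matrix.one_mulVec, modelB_three_mulVec, Matrix.smul_cons,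
    Matrix.smul_empty, Matrix.cons_add_cons, Matrix.empty_add_empty,
    Matrix.cons_sub_cons, Matrix.empty_sub_empty, smul_eq_mul, modelS_three_mulVec,
    Matrix.vecCons_inj, and_true]
  refine ⟨?_, ?_, ?_⟩ <;> field_simp <;> ring

theorem IsCofactor.aeval_modelB_two_identity (hf : IsCofactor 2 l g (X - C a)) (hl : l ≠ 0) :
    aeval (modelB 2 l g (X - C a)) (X - C a) *ᵥ (modelS 2 l g (X - C a) *ᵥ
      (aeval (modelB 2 l g (X - C a)) (X - C l) *ᵥ ![1, 0])) =
      ![0, (-l ^ 2 + l * a - a ^ 2) * l] := by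
  obtain rfl : l * a = g := by simpa [rootDegree] using hf.mul_coeff_zero
  ext i
  fin_cases i
  · simp [modelB, modelS, Matrix.algebraMap_eq_diagonal, hl]
  · simp [modelB, modelS, Matrix.algebraMap_eq_diagonal]
    field_simp
    ring

end Identity

section ModelIdentity

open scoped Matrix

variable {K : Type*} [Field K] {n : ℕ} {p : Param K (n + 2)}

theorem Q_three_eq_coeff (l : Fin 3 → K) (g : K) :
    let q := ∏ i ∈ (Finset.univ.erase 1).erase 0, (X - C (l i))
    Q (l, g) 0 1 = (l 0 ^ 2 - l 1 * q.coeff 0) * (l 1 ^ 2 - l 0 * q.coeff 0) := by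
  have hq : (Finset.univ.erase (1 : Fin 3)).erase 0 = {2} := rfl
  have hc : ({0, 1} : Finset (Fin 3))ᶜ = {2} := rfl
  simp [Q, hq, hc, -Finset.compl_insert]

theorem Q_four_eq_coeff (l : Fin 4 → K) (g : K) :
    let q := ∏ i ∈ (Finset.univ.erase 1).erase 0, (X - C (l i))
    Q (l, g) 0 1 = -g⁻¹ * (l 0 ^ 2 + g) * (l 1 ^ 2 + g) *
      (g ^ 2 - g * (l 0 + l 1) * q.coeff 1 + (l 0 ^ 2 + l 1 ^ 2) * q.coeff 0 +
        l 0 * l 1 * (q.coeff 1 ^ 2 - 2 * q.coeff 0)) := by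
  have hq : (Finset.univ.erase (1 : Fin 4)).erase 0 = {2, 3} := rfl
  have hc : (({0, 1} : Finset (Fin 4))ᶜ).offDiag = {(2, 3), (3, 2)} := rfl
  have hexpand : (X - C (l 2)) * (X - C (l 3)) = X ^ 2 - C (l 2 + l 3) * X + C (l 2 * l 3) := by
    simp only [C_add, C_mul]
    ring
  simp only [Q, hq, hc, Finset.prod_pair (show (2 : Fin 4) ≠ 3 by decide), hexpand,
    Finset.prod_pair (show ((2, 3) : Fin 4 × Fin 4) ≠ (3, 2) by decide)]
  congr 1
  simp [coeff_X, coeff_C]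
  ring

theorem Q_five_eq_coeff (l : Fin 5 → K) (g : K) :
    let q := ∏ i ∈ (Finset.univ.erase 1).erase 0, (X - C (l i))
    Q (l, g) 0 1 = (g ^ 8)⁻¹ * (g ^ 2 + l 0 * g + l 0 ^ 2) * (g ^ 2 + l 1 * g + l 1 ^ 2) *
      ((g ^ 6 - g ^ 4 * l 0 * q.coeff 2 + g ^ 2 * l 0 ^ 2 * q.coeff 1 - l 0 ^ 3 * q.coeff 0) *
        (g ^ 6 - g ^ 4 * l 1 * q.coeff 2 + g ^ 2 * l 1 ^ 2 * q.coeff 1 - l 1 ^ 3 * q.coeff 0)) := by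
  have hq : (Finset.univ.erase (1 : Fin 5)).erase 0 = {2, 3, 4} := rfl
  have hc : ({0, 1} : Finset (Fin 5))ᶜ = {2, 3, 4} := rfl
  have hprod (f : Fin 5 → K[X]) : ∏ i ∈ {2, 3, 4}, f i = f 2 * (f 3 * f 4) := by simp
  have hprod' (f : Fin 5 → K) : ∏ i ∈ {2, 3, 4}, f i = f 2 * (f 3 * f 4) := by simp
  have hexpand : (X - C (l 2)) * ((X - C (l 3)) * (X - C (l 4))) =
      X ^ 3 - C (l 2 + l 3 + l 4) * X ^ 2 + C (l 2 * l 3 + l 2 * l 4 + l 3 * l 4) * X -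
        C (l 2 * l 3 * l 4) := by
    simp only [C_add, C_mul]
    ring
  simp only [Q, hq, hc, hprod, hprod', hexpand, coeff_add, coeff_sub, coeff_C_mul, coeff_X_pow,
    coeff_X, coeff_C]
  congr 1
  norm_num
  ring

theorem aeval_modelB_P_identity (hp : p ∈ paramSpace K (n + 2)) (hn : n ≤ 3) :
    aeval (modelB (n + 2) (p.1 0) (root p) (P p.1 0)) (P p.1 0) *ᵥ
      (modelS (n + 2) (p.1 0) (root p) (P p.1 0) *ᵥ
        (aeval (modelB (n + 2) (p.1 0) (root p) (P p.1 0)) (P p.1 1) *ᵥ Pi.single 0 1)) =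
      (Q p 0 1 * p.1 0) • Pi.single 1 1 := by
  have hf := isCofactor_P hp
  have hl := hp.1 0
  have ha := hp.1 1
  have hg := root_ne_zero hp
  rw [P_eq_mul_prod_erase p.1 (zero_ne_one (α := Fin (n + 2))),
    P_eq_mul_prod_erase p.1 (zero_ne_one (α := Fin (n + 2))).symm, Finset.erase_right_comm] at *
  obtain ⟨l, g⟩ := p
  match n with
  | 0 =>
    have hq : (Finset.univ.erase (1 : Fin 2)).erase 0 = ∅ := rfl
    have h₀ : (Pi.single 0 1 : Fin 2 → K) = ![1, 0] := by ext i; fin_cases i <;> rfl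
    have h₁ : (Pi.single 1 1 : Fin 2 → K) = ![0, 1] := by ext i; fin_cases i <;> rfl
    simp only [hq, Finset.prod_empty, mul_one, h₀, h₁] at hf ⊢
    rw [hf.aeval_modelB_two_identity hl]
    simp [Q]
  | 1 =>
    have h₀ : (Pi.single 0 1 : Fin 3 → K) = ![1, 0, 0] := by ext i; fin_cases i <;> rfl
    have h₁ : (Pi.single 1 1 : Fin 3 → K) = ![0, 1, 0] := by ext i; fin_cases i <;> rfl
    rw [h₀, h₁, hf.aeval_modelB_three_identity hl ha hg, Q_three_eq_coeff]
    simp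
  | 2 =>
    have h₀ : (Pi.single 0 1 : Fin 4 → K) = ![1, 0, 0, 0] := by ext i; fin_cases i <;> rfl
    have h₁ : (Pi.single 1 1 : Fin 4 → K) = ![0, 1, 0, 0] := by ext i; fin_cases i <;> rfl
    rw [h₀, h₁, hf.aeval_modelB_four_identity hl ha hg, Q_four_eq_coeff]
    simp [root]
  | 3 =>
    have h₀ : (Pi.single 0 1 : Fin 5 → K) = ![1, 0, 0, 0, 0] := by ext i; fin_cases i <;> rfl
    have h₁ : (Pi.single 1 1 : Fin 5 → K) = ![0, 1, 0, 0, 0] := by ext i; fin_cases i <;> rfl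
    rw [h₀, h₁, hf.aeval_modelB_five_identity hl ha hg, Q_five_eq_coeff]
    simp [root]

theorem exists_aeval_modelB_prod_erase_ne_zero (hp : p ∈ paramSpace K (n + 2)) (hn : n ≤ 3) :
    ∃ j ≠ 1, (aeval (modelB (n + 2) (p.1 0) (root p) (P p.1 0))
      (∏ i ∈ (Finset.univ.erase 1).erase 0, (X - C (p.1 i))) *ᵥ Pi.single 0 1) j ≠ 0 := by
  have hf := isCofactor_P hp
  have hl := hp.1 0
  have ha := hp.1 1
  have hg := root_ne_zero hp
  rw [P_eq_mul_prod_erase p.1 (zero_ne_one (α := Fin (n + 2))).symm, Finset.erase_right_comm] at *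
  match n with
  | 0 =>
    have hq : (Finset.univ.erase (1 : Fin 2)).erase 0 = ∅ := rfl
    exact ⟨0, zero_ne_one, by simp [hq]⟩
  | 1 =>
    have h₀ : (Pi.single 0 1 : Fin 3 → K) = ![1, 0, 0] := by ext i; fin_cases i <;> rfl
    rw [h₀, hf.aeval_modelB_three_mulVec_e₀ hl ha hg]
    exact ⟨0, zero_ne_one, ha⟩
  | 2 =>
    have h₀ : (Pi.single 0 1 : Fin 4 → K) = ![1, 0, 0, 0] := by ext i; fin_cases i <;> rfl
    rw [h₀, hf.aeval_modelB_four_mulVec_e₀ hl ha hg]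
    exact ⟨3, by decide, ha⟩
  | 3 =>
    have h₀ : (Pi.single 0 1 : Fin 5 → K) = ![1, 0, 0, 0, 0] := by ext i; fin_cases i <;> rfl
    rw [h₀, hf.aeval_modelB_five_mulVec_e₀ hl ha hg]
    exact ⟨3, by decide, pow_ne_zero 2 ha⟩

theorem modelS_mulVec_single_zero (l g : K) (f : K[X]) (hn : n ≤ 3) :
    modelS (n + 2) l g f *ᵥ Pi.single 0 1 = l • Pi.single 1 1 := by
  match n with
  | 0 | 1 | 2 | 3 =>
    ext i
    fin_cases i <;> simp [modelS]

theorem modelT_mulVec_single_zero (l g : K) (f : K[X]) (hn : n ≤ 3) :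
    modelT (n + 2) l g f *ᵥ Pi.single 0 1 = Pi.single 1 1 := by
  match n with
  | 0 | 1 | 2 | 3 =>
    ext i
    fin_cases i <;> simp [modelT]

end ModelIdentity

section Braid

/-- The half twist `σ₁σ₂σ₁`. -/
def δ : B3 := σ₁ * σ₂ * σ₁

/-- The element `σ₁σ₂`, a cube root of `ζ`. -/
def τ : B3 := σ₁ * σ₂

theorem braid_rel : σ₁ * σ₂ * σ₁ = σ₂ * σ₁ * σ₂ := by
  have h := PresentedGroup.one_of_mem (rels := braidRelators) (Set.mem_singleton _)
  simp only [map_mul, map_inv] at h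
  exact mul_inv_eq_one.1 h

theorem τ_mul_σ₁ : τ * σ₁ = δ := rfl

theorem σ₂_mul_τ : σ₂ * τ = δ := by
  rw [δ, braid_rel, τ, mul_assoc]

theorem δ_mul_σ₁ : δ * σ₁ = σ₂ * δ := by
  rw [← σ₂_mul_τ, mul_assoc, τ_mul_σ₁, σ₂_mul_τ]

theorem δ_mul_σ₂ : δ * σ₂ = σ₁ * δ := by
  calc δ * σ₂ = σ₁ * (σ₂ * σ₁ * σ₂) := by simp only [δ, mul_assoc]
    _ = σ₁ * δ := by rw [← braid_rel, δ]

theorem δ_mul_δ : δ * δ = ζ := by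
  have h : δ * δ = τ * (σ₁ * σ₂) * τ := by
    rw [← σ₂_mul_τ, ← mul_assoc, σ₂_mul_τ, ← τ_mul_σ₁, mul_assoc τ]
  rw [h, ζ, ← τ, pow_succ, pow_two]

theorem τ_mul_τ_mul_τ : τ * (τ * τ) = ζ := by
  rw [ζ, ← τ, pow_succ, pow_two, mul_assoc]

theorem closure_pair_δ_τ : Subgroup.closure {δ, τ} = ⊤ := by
  have hδ : δ ∈ Subgroup.closure {δ, τ} := Subgroup.subset_closure (Set.mem_insert _ _)
  have hτ : τ ∈ Subgroup.closure {δ, τ} := Subgroup.subset_closure (Set.mem_insert_of_mem _ rfl)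
  rw [eq_top_iff, ← PresentedGroup.closure_range_of, Subgroup.closure_le, Set.range_subset_iff,
    Fin.forall_fin_two]
  constructor
  · rw [show PresentedGroup.of 0 = τ⁻¹ * δ from eq_inv_mul_of_mul_eq τ_mul_σ₁]
    exact Subgroup.mul_mem _ (Subgroup.inv_mem _ hτ) hδ
  · rw [show PresentedGroup.of 1 = δ * τ⁻¹ from eq_mul_inv_of_mul_eq σ₂_mul_τ]
    exact Subgroup.mul_mem _ hδ (Subgroup.inv_mem _ hτ)

theorem ζ_mem_center : ζ ∈ Subgroup.center B3 := by
  have h : Subgroup.closure {δ, τ} ≤ Subgroup.centralizer {ζ} := by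
    refine (Subgroup.closure_le _).2 (Set.pair_subset ?_ ?_) <;>
      refine Subgroup.mem_centralizer_singleton_iff.2 ?_
    · rw [← δ_mul_δ, mul_assoc]
    · rw [← τ_mul_τ_mul_τ, mul_assoc, mul_assoc]
  rw [closure_pair_δ_τ] at h
  exact Subgroup.mem_center_iff.2 fun g =>
    Subgroup.mem_centralizer_singleton_iff.1 (h (Subgroup.mem_top g))

/-- The homomorphism from `B3` that maps `σ₁σ₂σ₁` and `σ₁σ₂` to elements `s`, `t` with
`s ^ 2 = t ^ 3`. -/
def liftPair {G : Type*} [Group G] (s t : G) (h : s * s = t * (t * t)) : B3 →* G :=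
  PresentedGroup.toGroup (f := ![t⁻¹ * s, s * t⁻¹]) <| by
    rintro _ rfl
    simp only [map_mul, map_inv, FreeGroup.lift_apply_of, Matrix.cons_val_zero,
      Matrix.cons_val_one, mul_inv_eq_one]
    calc t⁻¹ * s * (s * t⁻¹) * (t⁻¹ * s) = t⁻¹ * (s * s) * t⁻¹ * t⁻¹ * s := by group
      _ = s := by rw [h]; group
      _ = s * t⁻¹ * t⁻¹ * (t * (t * t)) * t⁻¹ := by group
      _ = s * t⁻¹ * (t⁻¹ * s) * (s * t⁻¹) := by rw [← h]; group

section liftPair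

variable {G : Type*} [Group G] (s t : G) (h : s * s = t * (t * t))

theorem liftPair_σ₁ : liftPair s t h σ₁ = t⁻¹ * s := PresentedGroup.toGroup.of _

theorem liftPair_σ₂ : liftPair s t h σ₂ = s * t⁻¹ := PresentedGroup.toGroup.of _

theorem liftPair_τ : liftPair s t h τ = t := by
  rw [τ, map_mul, liftPair_σ₁, liftPair_σ₂]
  calc t⁻¹ * s * (s * t⁻¹) = t⁻¹ * (s * s) * t⁻¹ := by group
    _ = t := by rw [h]; group

theorem liftPair_δ : liftPair s t h δ = s := by
  rw [← τ_mul_σ₁, map_mul, liftPair_τ, liftPair_σ₁, mul_inv_cancel_left]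

end liftPair

end Braid

section Irreducible

variable {K G V : Type*} [Field K] [Group G] [AddCommGroup V] [Module K V]
  {ρ : Representation K G V}

theorem eq_bot_or_eq_top_of_isIrreducible (h : ρ.IsIrreducible) {N : Submodule K V}
    (hN : ∀ g, ∀ v ∈ N, ρ g v ∈ N) : N = ⊥ ∨ N = ⊤ :=
  (h.eq_bot_or_eq_top ⟨N, hN⟩).imp
    (congrArg Subrepresentation.toSubmodule) (congrArg Subrepresentation.toSubmodule)

theorem nontrivial_of_isIrreducible (h : ρ.IsIrreducible) : Nontrivial V := by
  by_contra hV
  rw [not_nontrivial_iff_subsingleton] at hV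
  exact bot_ne_top (α := Subrepresentation ρ)
    (Subrepresentation.toSubmodule_injective (Subsingleton.elim _ _))

theorem isIrreducible_of_forall [Nontrivial V]
    (h : ∀ N : Submodule K V, (∀ g, ∀ v ∈ N, ρ g v ∈ N) → N = ⊥ ∨ N = ⊤) : ρ.IsIrreducible where
  exists_pair_ne := ⟨⊥, ⊤, fun h =>
    bot_ne_top (α := Submodule K V) (congrArg Subrepresentation.toSubmodule h)⟩
  eq_bot_or_eq_top N := (h N.toSubmodule N.apply_mem_toSubmodule).imp
    (fun h => Subrepresentation.toSubmodule_injective h)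
    (fun h => Subrepresentation.toSubmodule_injective h)

variable [FiniteDimensional K V]

theorem exists_apply_eq_smul_one_of_mem_center [IsAlgClosed K] (h : ρ.IsIrreducible) {z : G}
    (hz : z ∈ Subgroup.center G) : ∃ c : K, ρ z = c • 1 := by
  have hschur := Representation.IsIrreducible.algebraMap_intertwiningMap_bijective_of_isAlgClosed
    (ρ := ρ)
  obtain ⟨c, hc⟩ := hschur.surjective (.centralMul ρ z hz)
  exact ⟨c, (congrArg Representation.IntertwiningMap.toLinearMap hc).symm⟩

theorem apply_mem_of_mem_closure {s : Set G} {N : Submodule K V} (hN : ∀ g ∈ s, ∀ v ∈ N, ρ g v ∈ N)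
    {g : G} (hg : g ∈ Subgroup.closure s) : ∀ v ∈ N, ρ g v ∈ N := by
  induction hg using Subgroup.closure_induction with
  | mem g hg => exact hN g hg
  | one => simp
  | mul a b _ _ ha hb =>
    intro v hv
    rw [map_mul, Module.End.mul_apply]
    exact ha _ (hb v hv)
  | inv a _ ha =>
    intro v hv
    have hinj : Function.Injective ((ρ a).restrict ha) := fun v w hvw =>
      Subtype.ext ((ρ.apply_bijective a).injective (congrArg Subtype.val hvw))
    obtain ⟨w, hw⟩ := LinearMap.injective_iff_surjective.1 hinj ⟨v, hv⟩
    have hwv : ρ a w = v := congrArg Subtype.val hw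
    rw [← hwv, ρ.inv_self_apply]
    exact w.2

end Irreducible

section Representation

variable {K V W : Type*} [Field K] [AddCommGroup V] [Module K V] [AddCommGroup W] [Module K W]

theorem map_aeval_apply {f : Module.End K V} {g : Module.End K W} {φ : V →ₗ[K] W}
    (h : ∀ v, φ (f v) = g (φ v)) (q : K[X]) (v : V) : φ (aeval f q v) = aeval g q (φ v) := by
  have hpow (n : ℕ) : φ ((f ^ n) v) = (g ^ n) (φ v) := (LinearMap.congr_fun
    (Module.End.commute_pow_left_of_commute (LinearMap.ext fun v => (h v).symm) n) v).symm
  induction q using Polynomial.induction_on' with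
  | add p q hp hq => simp only [map_add, LinearMap.add_apply, hp, hq]
  | monomial n a => simp [aeval_monomial, hpow]

variable (ρ : Representation K B3 V)

theorem apply_τ_apply_σ₁ (v : V) : ρ τ (ρ σ₁ v) = ρ δ v := by
  rw [← τ_mul_σ₁, map_mul, Module.End.mul_apply]

theorem apply_δ_apply_σ₁ (v : V) : ρ δ (ρ σ₁ v) = ρ σ₂ (ρ δ v) := by
  rw [← Module.End.mul_apply, ← map_mul, δ_mul_σ₁, map_mul, Module.End.mul_apply]

theorem apply_δ_apply_σ₂ (v : V) : ρ δ (ρ σ₂ v) = ρ σ₁ (ρ δ v) := by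
  rw [← Module.End.mul_apply, ← map_mul, δ_mul_σ₂, map_mul, Module.End.mul_apply]

theorem apply_δ_apply_δ (v : V) : ρ δ (ρ δ v) = ρ ζ v := by
  rw [← Module.End.mul_apply, ← map_mul, δ_mul_δ]

theorem apply_τ_apply_τ_apply_τ (v : V) : ρ τ (ρ τ (ρ τ v)) = ρ ζ v := by
  rw [← Module.End.mul_apply, ← Module.End.mul_apply, ← map_mul, ← map_mul,
    mul_assoc, τ_mul_τ_mul_τ]

theorem apply_δ_aeval_σ₁ (q : K[X]) (v : V) :
    ρ δ (aeval (ρ σ₁) q v) = aeval (ρ σ₂) q (ρ δ v) :=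
  map_aeval_apply (apply_δ_apply_σ₁ ρ) q v

theorem apply_δ_aeval_σ₂ (q : K[X]) (v : V) :
    ρ δ (aeval (ρ σ₂) q v) = aeval (ρ σ₁) q (ρ δ v) :=
  map_aeval_apply (apply_δ_apply_σ₂ ρ) q v

theorem charpoly_σ₂ [FiniteDimensional K V] : (ρ σ₂).charpoly = (ρ σ₁).charpoly := by
  rw [← LinearEquiv.charpoly_conj (LinearEquiv.ofBijective (ρ δ) (ρ.apply_bijective δ)) (ρ σ₁)]
  congr 1
  ext v
  obtain ⟨w, rfl⟩ := (ρ.apply_bijective δ).surjective v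
  rw [← apply_δ_apply_σ₁, LinearEquiv.conj_apply_apply]
  exact congrArg (ρ δ ∘ ρ σ₁) (LinearEquiv.ofBijective_symm_apply_apply _ _).symm

variable {ρ}

theorem σ₁_apply_eq_smul_iff {l : K} {v : V} : ρ σ₁ v = l • v ↔ ρ δ v = l • ρ τ v := by
  rw [← apply_τ_apply_σ₁, ← map_smul, (ρ.apply_bijective τ).injective.eq_iff]

theorem nonempty_equiv {ρ' : Representation K B3 W} (e : V ≃ₗ[K] W)
    (hδ : ∀ v, e (ρ δ v) = ρ' δ (e v)) (hτ : ∀ v, e (ρ τ v) = ρ' τ (e v)) :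
    Nonempty (ρ.Equiv ρ') := by
  have h (g : B3) : ∀ v, e (ρ g v) = ρ' g (e v) := by
    have hg : g ∈ Subgroup.closure {δ, τ} := closure_pair_δ_τ ▸ Subgroup.mem_top g
    induction hg using Subgroup.closure_induction with
    | mem g hg => rcases hg with rfl | rfl <;> assumption
    | one => simp
    | mul a b _ _ ha hb => simp [ha, hb]
    | inv a _ ha => exact fun v => by rw [eq_comm, ρ'.inv_apply_eq_iff, ← ha, ρ.self_inv_apply]
  exact ⟨.mk e fun g => LinearMap.ext (h g)⟩

theorem exists_isSimplePair [IsAlgClosed K] [FiniteDimensional K V] (h : ρ.IsIrreducible) :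
    ∃ c : K, ρ ζ = c • 1 ∧ IsSimplePair c (ρ δ) (ρ τ) := by
  have := nontrivial_of_isIrreducible h
  obtain ⟨c, hc⟩ := exists_apply_eq_smul_one_of_mem_center h ζ_mem_center
  have hζ (v : V) : ρ ζ v = c • v := LinearMap.congr_fun hc v
  refine ⟨c, hc, ?_, fun v => ?_, fun v => ?_, fun N hδ hτ => ?_⟩
  · rintro rfl
    obtain ⟨v, hv⟩ := exists_ne (0 : V)
    exact hv ((ρ.apply_bijective ζ).injective (by rw [hζ, zero_smul, map_zero]))
  · rw [apply_δ_apply_δ, hζ]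
  · rw [apply_τ_apply_τ_apply_τ, hζ]
  · refine eq_bot_or_eq_top_of_isIrreducible h fun g =>
      apply_mem_of_mem_closure (s := {δ, τ}) ?_ (closure_pair_δ_τ ▸ Subgroup.mem_top g)
    rintro _ (rfl | rfl)
    exacts [hδ, hτ]

end Representation

section ModelRepresentation

/-- An element whose square is a nonzero scalar, as a unit. -/
def unitOfSq {K R : Type*} [Field K] [Ring R] [Algebra K R] (s : R) {c : K} (hc : c ≠ 0)
    (h : s * s = c • 1) : Rˣ where
  val := s
  inv := c⁻¹ • s
  val_inv := by rw [mul_smul_comm, h, inv_smul_smul₀ hc]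
  inv_val := by rw [smul_mul_assoc, h, inv_smul_smul₀ hc]

/-- An element whose cube is a nonzero scalar, as a unit. -/
def unitOfCube {K R : Type*} [Field K] [Ring R] [Algebra K R] (t : R) {c : K} (hc : c ≠ 0)
    (h : t * (t * t) = c • 1) : Rˣ where
  val := t
  inv := c⁻¹ • (t * t)
  val_inv := by rw [mul_smul_comm, h, inv_smul_smul₀ hc]
  inv_val := by rw [smul_mul_assoc, mul_assoc, h, inv_smul_smul₀ hc]

variable {K : Type*} [Field K] (d : ℕ) {l g : K} (f : K[X]) (hl : l ≠ 0) (hg : g ≠ 0)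

/-- The representation of `B3` on `K ^ d` in which `σ₁σ₂σ₁` and `σ₁σ₂` act by the matrices
`modelS` and `modelT`. -/
noncomputable def modelRep : Representation K B3 (Fin d → K) :=
  ((Matrix.toLinAlgEquiv' : Matrix (Fin d) (Fin d) K ≃ₐ[K] _) :
    Matrix (Fin d) (Fin d) K →* Module.End K (Fin d → K)).comp <| (Units.coeHom _).comp <|
      liftPair (unitOfSq _ (modelScalar_ne_zero d hg) (modelS_mul_modelS d f hl hg))
        (unitOfCube _ (modelScalar_ne_zero d hg) (modelT_mul_modelT_mul_modelT d l f hg))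
        (Units.ext ((modelS_mul_modelS d f hl hg).trans
          (modelT_mul_modelT_mul_modelT d l f hg).symm))

theorem modelRep_δ : modelRep d f hl hg δ = Matrix.toLinAlgEquiv' (modelS d l g f) := by
  simp only [modelRep, MonoidHom.comp_apply, liftPair_δ]
  rfl

theorem modelRep_τ : modelRep d f hl hg τ = Matrix.toLinAlgEquiv' (modelT d l g f) := by
  simp only [modelRep, MonoidHom.comp_apply, liftPair_τ]
  rfl

theorem modelRep_ζ : modelRep d f hl hg ζ = modelScalar d g • 1 := by
  rw [← δ_mul_δ, map_mul, modelRep_δ, ← map_mul, modelS_mul_modelS d f hl hg, map_smul, map_one]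

theorem modelRep_σ₂ : modelRep d f hl hg σ₂ = Matrix.toLinAlgEquiv' (modelB d l g f) := by
  have hτ : IsUnit (modelRep d f hl hg τ) := (Group.isUnit τ).map _
  rw [← hτ.mul_left_inj, ← map_mul, σ₂_mul_τ, modelRep_δ, modelRep_τ, ← map_mul,
    modelB_mul_modelT d f hl hg]

variable {d f}

theorem charpoly_modelRep_σ₁ (hf : IsCofactor d l g f) (hd : d ≤ 5) :
    (modelRep d f hl hg σ₁).charpoly = (X - C l) * f := by
  rw [← charpoly_σ₂, modelRep_σ₂, ← hf.charpoly_modelB hd hl hg]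
  exact Matrix.charpoly_toLin' _

theorem ne_zero_of_hasEigenvalue {G V : Type*} [Group G] [AddCommGroup V] [Module K V]
    {ρ : Representation K G V} {a : G} (h : Module.End.HasEigenvalue (ρ a) l) : l ≠ 0 := by
  rintro rfl
  obtain ⟨v, hv⟩ := h.exists_hasEigenvector
  exact hv.2 ((ρ.apply_bijective a).injective (by rw [hv.apply_eq_smul, zero_smul, map_zero]))

variable {V : Type*} [AddCommGroup V] [Module K V] [FiniteDimensional K V]
  {ρ : Representation K B3 V}

theorem hasEigenvalue_of_charpoly_eq {A : Module.End K V} {l : Fin d → K}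
    (h : A.charpoly = ∏ i, (X - C (l i))) (i : Fin d) : A.HasEigenvalue (l i) := by
  rw [Module.End.hasEigenvalue_iff_isRoot_charpoly, h, Polynomial.IsRoot, eval_prod]
  exact Finset.prod_eq_zero (Finset.mem_univ i) (by simp)

theorem exists_nonempty_equiv_modelRep [IsAlgClosed K] (hρ : ρ.IsIrreducible)
    (hd : Module.finrank K V = d) (hd5 : d ≤ 5) (hl : l ≠ 0)
    (heig : Module.End.HasEigenvalue (ρ σ₁) l) :
    ∃ (g : K) (f : K[X]) (hg : g ≠ 0), IsCofactor d l g f ∧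
      Nonempty (ρ.Equiv (modelRep d f hl hg)) := by
  have := nontrivial_of_isIrreducible hρ
  obtain ⟨c, -, h⟩ := exists_isSimplePair hρ
  obtain ⟨u, hu⟩ := heig.exists_hasEigenvector
  obtain ⟨b, g, f, hg, -, hf, hS, hT⟩ := h.exists_basis_toMatrix_eq hl hu.2
    (σ₁_apply_eq_smul_iff.1 hu.apply_eq_smul) hd (hd ▸ Module.finrank_pos) hd5
  refine ⟨g, f, hg, hf, nonempty_equiv b.equivFun (fun v => ?_) fun v => ?_⟩
  · rw [modelRep_δ, Matrix.toLinAlgEquiv'_apply, ← hS]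
    exact (LinearMap.toMatrix_mulVec_repr b b _ v).symm
  · rw [modelRep_τ, Matrix.toLinAlgEquiv'_apply, ← hT]
    exact (LinearMap.toMatrix_mulVec_repr b b _ v).symm

end ModelRepresentation

section ParamRep

variable {K : Type*} [Field K] {d : ℕ} [NeZero d] {p : Param K d}

/-- The candidate for a simple module with parameter `p`, written with respect to the first
eigenvalue. -/
noncomputable abbrev paramRep (hp : p ∈ paramSpace K d) : Representation K B3 (Fin d → K) :=
  modelRep d (P p.1 0) (hp.1 0) (root_ne_zero hp)

theorem hasParam_paramRep (hp : p ∈ paramSpace K d) (hd : d ≤ 5) : HasParam (paramRep hp) p where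
  charpoly_eq := by
    rw [charpoly_modelRep_σ₁ _ _ (isCofactor_P hp) hd, X_sub_C_mul_P]
  mem := hp
  central := centralCondition_of_apply_ζ (modelRep_ζ _ _ _ _)

variable {V : Type*} [AddCommGroup V] [Module K V] [FiniteDimensional K V]
  {ρ : Representation K B3 V} [IsAlgClosed K]

theorem exists_nonempty_equiv_paramRep (hρ : ρ.IsIrreducible) {l : Fin d → K}
    (hl : (ρ σ₁).charpoly = ∏ i, (X - C (l i))) (hd : d ≤ 5) :
    ∃ (p : Param K d) (hp : p ∈ paramSpace K d), p.1 = l ∧ Nonempty (ρ.Equiv (paramRep hp)) := by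
  have heig (i : Fin d) : Module.End.HasEigenvalue (ρ σ₁) (l i) := hasEigenvalue_of_charpoly_eq hl i
  have hne (i : Fin d) : l i ≠ 0 := ne_zero_of_hasEigenvalue (heig i)
  have hfin : Module.finrank K V = d := by
    rw [← LinearMap.charpoly_natDegree (ρ σ₁), hl, natDegree_finsetProd_X_sub_C_eq_card,
      Finset.card_univ, Fintype.card_fin]
  obtain ⟨g, f, hg, hf, ⟨e⟩⟩ := exists_nonempty_equiv_modelRep hρ hfin hd (hne 0) (heig 0)
  obtain rfl : f = P l 0 := by
    refine mul_left_cancel₀ (X_sub_C_ne_zero (l 0)) ?_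
    rw [X_sub_C_mul_P, ← hl, ← charpoly_modelRep_σ₁ (hne 0) hg hf hd, ← e.conj_apply_self,
      LinearEquiv.charpoly_conj]
  have hroot : g ^ rootDegree d = ∏ i, l i :=
    mul_left_cancel₀ (pow_ne_zero (P l 0).natDegree (neg_ne_zero.2 one_ne_zero))
      (hf.mul_coeff_zero.symm.trans (mul_coeff_zero_P l 0))
  obtain ⟨p, hp, rfl, rfl⟩ := exists_root_eq hne hroot
  exact ⟨p, hp, rfl, ⟨e⟩⟩

theorem exists_hasParam (hρ : ρ.IsIrreducible) (hd5 : d ≤ 5) (hd : Module.finrank K V = d) :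
    ∃ p : Param K d, HasParam ρ p := by
  obtain ⟨l, hl⟩ := exists_prod_eq_of_monic (LinearMap.charpoly_monic (ρ σ₁))
    ((LinearMap.charpoly_natDegree _).trans hd)
  obtain ⟨p, hp, -, ⟨e⟩⟩ := exists_nonempty_equiv_paramRep hρ hl hd5
  exact ⟨p, (hasParam_paramRep hp hd5).of_equiv e.symm⟩

theorem HasParam.nonempty_equiv_paramRep (h : HasParam ρ p) (hρ : ρ.IsIrreducible) (hd : d ≤ 5) :
    Nonempty (ρ.Equiv (paramRep h.mem)) := by
  have := nontrivial_of_isIrreducible hρ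
  obtain ⟨q, hq, hqp, ⟨e⟩⟩ := exists_nonempty_equiv_paramRep hρ h.charpoly_eq hd
  obtain rfl : q = p := Prod.ext hqp (h.snd_eq ((hasParam_paramRep hq hd).of_equiv e.symm))
  exact ⟨e⟩

end ParamRep

section ParamRepIdentity

open scoped Matrix

variable {K : Type*} [Field K]

theorem aeval_toLinAlgEquiv'_apply {d : ℕ} (M : Matrix (Fin d) (Fin d) K) (q : K[X])
    (v : Fin d → K) : aeval (Matrix.toLinAlgEquiv' M) q v = aeval M q *ᵥ v := by
  rw [aeval_algHom_apply, Matrix.toLinAlgEquiv'_apply]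

variable {n : ℕ}

theorem modelRep_δ_single_zero {l g : K} (f : K[X]) (hl : l ≠ 0) (hg : g ≠ 0) (hn : n ≤ 3) :
    modelRep (n + 2) f hl hg δ (Pi.single 0 1) = l • Pi.single 1 1 := by
  rw [modelRep_δ, Matrix.toLinAlgEquiv'_apply, modelS_mulVec_single_zero l g f hn]

theorem modelRep_σ₁_single_zero {l g : K} (f : K[X]) (hl : l ≠ 0) (hg : g ≠ 0) (hn : n ≤ 3) :
    modelRep (n + 2) f hl hg σ₁ (Pi.single 0 1) = l • Pi.single 0 1 := by
  rw [σ₁_apply_eq_smul_iff, modelRep_δ_single_zero f hl hg hn, modelRep_τ,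
    Matrix.toLinAlgEquiv'_apply, modelT_mulVec_single_zero l g f hn]

variable {p : Param K (n + 2)}

theorem aeval_paramRep_identity_one (hp : p ∈ paramSpace K (n + 2)) (hn : n ≤ 3) :
    aeval (paramRep hp σ₁) (P p.1 0) (aeval (paramRep hp σ₂) (P p.1 1) (Pi.single 0 1)) =
      Q p 0 1 • Pi.single 0 1 := by
  apply ((paramRep hp).apply_bijective δ).injective
  rw [apply_δ_aeval_σ₁, map_smul, modelRep_δ_single_zero _ _ _ hn, smul_smul,
    ← aeval_modelB_P_identity hp hn, modelRep_σ₂, modelRep_δ, aeval_toLinAlgEquiv'_apply,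
    aeval_toLinAlgEquiv'_apply, Matrix.toLinAlgEquiv'_apply]

theorem paramRep_comp_perm {d : ℕ} [NeZero d] {p : Param K d} (hp : p ∈ paramSpace K d)
    {π : Equiv.Perm (Fin d)} (hπ : π 0 = 0) :
    paramRep (comp_perm_mem_paramSpace hp π) = paramRep hp := by
  simp only [paramRep, P_comp_perm, root_comp_perm, Function.comp_apply, hπ]

theorem aeval_paramRep_identity (hp : p ∈ paramSpace K (n + 2)) (hn : n ≤ 3) {s : Fin (n + 2)}
    (hs : s ≠ 0) :
    aeval (paramRep hp σ₁) (P p.1 0) (aeval (paramRep hp σ₂) (P p.1 s) (Pi.single 0 1)) =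
      Q p 0 s • Pi.single 0 1 := by
  have h0 : Equiv.swap 1 s 0 = 0 := Equiv.swap_apply_of_ne_of_ne (by simp) hs.symm
  have h := aeval_paramRep_identity_one (comp_perm_mem_paramSpace hp (Equiv.swap 1 s)) hn
  rwa [paramRep_comp_perm hp h0, P_comp_perm, P_comp_perm, Q_comp_perm, h0,
    Equiv.swap_apply_left] at h

theorem aeval_paramRep_prod_erase_ne_smul (hp : p ∈ paramSpace K (n + 2)) (hn : n ≤ 3) (k : K) :
    aeval (paramRep hp σ₂) (∏ i ∈ (Finset.univ.erase 1).erase 0, (X - C (p.1 i)))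
      (Pi.single 0 1) ≠ k • paramRep hp δ (Pi.single 0 1) := by
  obtain ⟨j, hj, hne⟩ := exists_aeval_modelB_prod_erase_ne_zero hp hn
  rw [modelRep_δ_single_zero _ _ _ hn, modelRep_σ₂, aeval_toLinAlgEquiv'_apply]
  intro h
  exact hne (by simp [h, hj])

end ParamRepIdentity

section Identity

variable {K V : Type*} [Field K] [AddCommGroup V] [Module K V] [FiniteDimensional K V]
  {ρ : Representation K B3 V}

theorem HasParam.σ₁_apply_aeval {d : ℕ} {p : Param K d} (h : HasParam ρ p) (r : Fin d) (v : V) :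
    ρ σ₁ (aeval (ρ σ₁) (P p.1 r) v) = p.1 r • aeval (ρ σ₁) (P p.1 r) v := by
  have h' := LinearMap.congr_fun (LinearMap.aeval_self_charpoly (ρ σ₁)) v
  rw [h.charpoly_eq, ← X_sub_C_mul_P p.1 r, map_mul, Module.End.mul_apply, map_sub, aeval_X,
    aeval_C, LinearMap.sub_apply, Module.algebraMap_end_apply, LinearMap.zero_apply,
    sub_eq_zero] at h'
  exact h'

variable [IsAlgClosed K]

theorem exists_smul_eq_of_σ₁_apply_eq_smul (hρ : ρ.IsIrreducible) (hd : Module.finrank K V ≤ 5)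
    {l : K} (hl : l ≠ 0) {u v : V} (hu0 : u ≠ 0) (hu : ρ σ₁ u = l • u) (hv : ρ σ₁ v = l • v) :
    ∃ k : K, k • u = v := by
  obtain ⟨c, -, h⟩ := exists_isSimplePair hρ
  exact h.exists_smul_eq hd hl hu0 (σ₁_apply_eq_smul_iff.1 hu) (σ₁_apply_eq_smul_iff.1 hv)

theorem HasParam.exists_eigenvector {n : ℕ} {p : Param K (n + 2)} (h : HasParam ρ p)
    (hρ : ρ.IsIrreducible) (hn : n ≤ 3) :
    ∃ u : V, u ≠ 0 ∧ ρ σ₁ u = p.1 0 • u ∧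
      aeval (ρ σ₁) (P p.1 0) (aeval (ρ σ₂) (P p.1 1) u) = Q p 0 1 • u ∧
      ∀ k : K, aeval (ρ σ₂) (∏ i ∈ (Finset.univ.erase 1).erase 0, (X - C (p.1 i))) u ≠
        k • ρ δ u := by
  obtain ⟨e⟩ := h.nonempty_equiv_paramRep hρ (by omega)
  set E := e.symm.toLinearEquiv
  have hE (g : B3) (v : Fin (n + 2) → K) : E (paramRep h.mem g v) = ρ g (E v) :=
    LinearMap.congr_fun (e.symm.isIntertwining' g) v
  have hEa (g : B3) (q : K[X]) (v : Fin (n + 2) → K) :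
      E (aeval (paramRep h.mem g) q v) = aeval (ρ g) q (E v) :=
    map_aeval_apply (φ := E.toLinearMap) (hE g) q v
  refine ⟨E (Pi.single 0 1), ?_, ?_, ?_, fun k hk => ?_⟩
  · exact E.map_ne_zero_iff.2 (Pi.single_ne_zero_iff.2 one_ne_zero)
  · rw [← hE, modelRep_σ₁_single_zero _ _ _ hn, map_smul]
  · rw [← hEa, ← hEa, aeval_paramRep_identity_one h.mem hn, map_smul]
  · rw [← hEa, ← hE, ← map_smul] at hk
    exact aeval_paramRep_prod_erase_ne_smul h.mem hn k (E.injective hk)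

/-- If `(σ₂ - l) q(σ₂) u` vanished, `δ⁻¹ q(σ₂) u` would be an eigenvector of `σ₁` with eigenvalue
`l`, hence a multiple of `u`. -/
theorem aeval_mul_apply_ne_zero (hρ : ρ.IsIrreducible) (hd : Module.finrank K V ≤ 5)
    {l : K} (hl : l ≠ 0) {u : V} (hu0 : u ≠ 0) (hu : ρ σ₁ u = l • u) {q : K[X]}
    (hq : ∀ k : K, aeval (ρ σ₂) q u ≠ k • ρ δ u) : aeval (ρ σ₂) ((X - C l) * q) u ≠ 0 := by
  intro h
  obtain ⟨w, hw⟩ := (ρ.apply_bijective δ).surjective (aeval (ρ σ₂) q u)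
  have hσ₁ : ρ σ₁ w = l • w := by
    apply (ρ.apply_bijective δ).injective
    rw [apply_δ_apply_σ₁, map_smul, hw, ← sub_eq_zero, ← h]
    simp
  obtain ⟨k, rfl⟩ := exists_smul_eq_of_σ₁_apply_eq_smul hρ hd hl hu0 hu hσ₁
  exact hq k (by rw [← hw, map_smul])

variable {d : ℕ} {p : Param K d} {r s : Fin d}

theorem exists_eq_add_two_of_ne (hrs : r ≠ s) : ∃ n, d = n + 2 := by
  have := Fin.val_ne_of_ne hrs
  exact ⟨d - 2, by omega⟩

theorem HasParam.aeval_aeval_apply (h : HasParam ρ p) (hρ : ρ.IsIrreducible) (hd : d ≤ 5)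
    (hrs : r ≠ s) {u : V} (hu0 : u ≠ 0) (hu : ρ σ₁ u = p.1 r • u) :
    aeval (ρ σ₂) (P p.1 s) u ≠ 0 ∧
      aeval (ρ σ₁) (P p.1 r) (aeval (ρ σ₂) (P p.1 s) u) = Q p r s • u := by
  obtain ⟨n, rfl⟩ := exists_eq_add_two_of_ne hrs
  obtain ⟨π, rfl, rfl⟩ := exists_perm_apply hrs
  have hfin : Module.finrank K V ≤ 5 := h.finrank_eq ▸ hd
  have hl := h.mem.1 (π 0)
  obtain ⟨v, hv0, hv, hid, hne⟩ := (h.comp_perm π).exists_eigenvector hρ (by omega)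
  obtain ⟨k, rfl⟩ := exists_smul_eq_of_σ₁_apply_eq_smul hρ hfin hl hv0 hv hu
  rw [← P_comp_perm, ← P_comp_perm, ← Q_comp_perm]
  constructor
  · rw [map_smul, P_eq_mul_prod_erase _ (zero_ne_one' (Fin (n + 2)))]
    exact smul_ne_zero (left_ne_zero_of_smul hu0) (aeval_mul_apply_ne_zero hρ hfin hl hv0 hv hne)
  · rw [map_smul, map_smul, hid, smul_comm]

theorem HasParam.Q_ne_zero (h : HasParam ρ p) (hρ : ρ.IsIrreducible) (hd : d ≤ 5) (hrs : r ≠ s) :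
    Q p r s ≠ 0 := by
  obtain ⟨u, hu⟩ := (hasEigenvalue_of_charpoly_eq h.charpoly_eq r).exists_hasEigenvector
  obtain ⟨hne, hid⟩ := h.aeval_aeval_apply hρ hd hrs hu.2 hu.apply_eq_smul
  intro hQ
  rw [hQ, zero_smul] at hid
  have hw : ρ σ₁ (ρ δ (aeval (ρ σ₂) (P p.1 s) u)) =
      p.1 s • ρ δ (aeval (ρ σ₂) (P p.1 s) u) := by
    rw [apply_δ_aeval_σ₂, h.σ₁_apply_aeval]
  refine (h.aeval_aeval_apply hρ hd hrs.symm ?_ hw).1 ?_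
  · exact fun h0 => hne ((ρ.apply_bijective δ).injective (h0.trans (map_zero _).symm))
  · rw [← apply_δ_aeval_σ₁, hid, map_zero]

theorem HasParam.aeval_ne_zero (h : HasParam ρ p) (hρ : ρ.IsIrreducible) (hd : d ≤ 5)
    (hrs : r ≠ s) : aeval (ρ σ₁) (P p.1 r) ≠ 0 := by
  obtain ⟨u, hu⟩ := (hasEigenvalue_of_charpoly_eq h.charpoly_eq r).exists_hasEigenvector
  intro h0
  have hid := (h.aeval_aeval_apply hρ hd hrs hu.2 hu.apply_eq_smul).2
  rw [h0, LinearMap.zero_apply] at hid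
  exact smul_ne_zero (h.Q_ne_zero hρ hd hrs) hu.2 hid.symm

theorem HasParam.aeval_mul_aeval_mul_aeval (h : HasParam ρ p) (hρ : ρ.IsIrreducible) (hd : d ≤ 5)
    (hrs : r ≠ s) :
    aeval (ρ σ₁) (P p.1 r) * aeval (ρ σ₂) (P p.1 s) * aeval (ρ σ₁) (P p.1 r) =
      Q p r s • aeval (ρ σ₁) (P p.1 r) := by
  ext v
  simp only [Module.End.mul_apply, LinearMap.smul_apply]
  by_cases h0 : aeval (ρ σ₁) (P p.1 r) v = 0
  · rw [h0, map_zero, map_zero, smul_zero]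
  · exact (h.aeval_aeval_apply hρ hd hrs h0 (h.σ₁_apply_aeval r v)).2

end Identity

section Existence

variable {K : Type*} [Field K]

section InvariantSubspace

variable {V : Type*} [AddCommGroup V] [Module K V] [FiniteDimensional K V] {f : Module.End K V}
  {N : Submodule K V} (h : N ≤ N.comap f)

theorem charpoly_eq_charpoly_restrict_mul_charpoly_mapQ [Infinite K] :
    f.charpoly = (f.restrict h).charpoly * (N.mapQ N f h).charpoly := by
  refine Polynomial.funext fun x => ?_
  have hx : N ≤ N.comap (algebraMap K (Module.End K V) x - f) := fun v hv =>
    N.sub_mem (N.smul_mem x hv) (h hv)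
  rw [eval_mul, LinearMap.eval_charpoly, LinearMap.eval_charpoly, LinearMap.eval_charpoly,
    LinearMap.det_eq_det_mul_det N _ hx]
  congr 2
  ext v
  simp

theorem aeval_apply_eq_zero_of_charpoly_restrict_dvd {q : K[X]}
    (hq : (f.restrict h).charpoly ∣ q) {v : V} (hv : v ∈ N) : aeval f q v = 0 := by
  have hq0 : aeval (f.restrict h) q = 0 :=
    minpoly.dvd_iff.1 ((LinearMap.minpoly_dvd_charpoly _).trans hq)
  have hv' := map_aeval_apply (f := f.restrict h) (g := f) (φ := N.subtype) (fun _ => rfl) q ⟨v, hv⟩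
  rw [hq0, LinearMap.zero_apply, map_zero] at hv'
  exact hv'.symm

theorem aeval_apply_mem_of_charpoly_mapQ_dvd {q : K[X]} (hq : (N.mapQ N f h).charpoly ∣ q)
    (v : V) : aeval f q v ∈ N := by
  have hq0 : aeval (N.mapQ N f h) q = 0 :=
    minpoly.dvd_iff.1 ((LinearMap.minpoly_dvd_charpoly _).trans hq)
  have hv := map_aeval_apply (f := f) (g := N.mapQ N f h) (φ := N.mkQ) (fun _ => rfl) q v
  rw [hq0, LinearMap.zero_apply] at hv
  exact (Submodule.Quotient.mk_eq_zero N).1 hv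

omit h in
theorem degree_charpoly_ne_zero [Nontrivial V] (f : Module.End K V) : f.charpoly.degree ≠ 0 := by
  rw [degree_eq_natDegree (LinearMap.charpoly_monic f).ne_zero, LinearMap.charpoly_natDegree]
  exact_mod_cast Module.finrank_pos.ne'

end InvariantSubspace

variable [IsAlgClosed K]

theorem exists_dvd_P_of_mul_eq_prod {d : ℕ} {l : Fin d → K} {f h : K[X]} (hf : f.degree ≠ 0)
    (hfh : f * h = ∏ i, (X - C (l i))) {i : Fin d} (hi : X - C (l i) ∣ h) :
    ∃ s, s ≠ i ∧ f ∣ P l i ∧ h ∣ P l s := by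
  obtain ⟨h', rfl⟩ := hi
  have hP : f * h' = P l i := by
    refine mul_left_cancel₀ (X_sub_C_ne_zero (l i)) ?_
    rw [X_sub_C_mul_P, ← hfh]
    ring
  obtain ⟨x, hx⟩ := IsAlgClosed.exists_root f hf
  obtain ⟨s, hs, rfl⟩ : ∃ s, s ≠ i ∧ l s = x := by
    have hPx : (P l i).eval x = 0 := by rw [← hP, eval_mul, hx.eq_zero, zero_mul]
    rw [P, eval_prod, Finset.prod_eq_zero_iff] at hPx
    obtain ⟨s, hs, hsx⟩ := hPx
    exact ⟨s, Finset.ne_of_mem_erase hs, (by simpa [sub_eq_zero] using hsx : x = l s).symm⟩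
  obtain ⟨f', rfl⟩ := dvd_iff_isRoot.2 hx
  refine ⟨s, hs, Dvd.intro _ hP, Dvd.intro_left f' ?_⟩
  refine mul_left_cancel₀ (X_sub_C_ne_zero (l s)) ?_
  rw [X_sub_C_mul_P, ← hfh]
  ring

variable {d : ℕ}

theorem exists_aeval_aeval_eq_zero_of_invariant {V : Type*} [AddCommGroup V] [Module K V]
    [FiniteDimensional K V] {ρ : Representation K B3 V} {l : Fin d → K}
    (hl : (ρ σ₁).charpoly = ∏ i, (X - C (l i))) {N : Submodule K V}
    (hN : ∀ g, ∀ v ∈ N, ρ g v ∈ N) (hbot : N ≠ ⊥) (htop : N ≠ ⊤) (i : Fin d) :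
    ∃ s, s ≠ i ∧ ((∀ v, aeval (ρ σ₁) (P l i) (aeval (ρ σ₂) (P l s) v) = 0) ∨
      ∀ v, aeval (ρ σ₂) (P l s) (aeval (ρ σ₁) (P l i) v) = 0) := by
  have hle : N ≤ N.comap (ρ σ₁) := hN σ₁
  have : Infinite K := IsAlgClosed.instInfinite
  have : Nontrivial N := Submodule.nontrivial_iff_ne_bot.2 hbot
  have : Nontrivial (V ⧸ N) := Submodule.Quotient.nontrivial_iff.2 htop
  have hmul := (charpoly_eq_charpoly_restrict_mul_charpoly_mapQ hle).symm.trans hl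
  have hdvd : X - C (l i) ∣ ((ρ σ₁).restrict hle).charpoly * (N.mapQ N (ρ σ₁) hle).charpoly := by
    rw [hmul]
    exact Finset.dvd_prod_of_mem _ (Finset.mem_univ i)
  rcases (prime_X_sub_C (l i)).dvd_or_dvd hdvd with hi | hi
  · obtain ⟨s, hs, hPi, hPs⟩ := exists_dvd_P_of_mul_eq_prod (degree_charpoly_ne_zero _)
      ((mul_comm _ _).trans hmul) hi
    refine ⟨s, hs, Or.inr fun v => ?_⟩
    have hmem := hN δ⁻¹ _ (aeval_apply_mem_of_charpoly_mapQ_dvd hle hPi v)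
    rw [← ρ.self_inv_apply δ (aeval (ρ σ₁) (P l i) v), ← apply_δ_aeval_σ₁,
      aeval_apply_eq_zero_of_charpoly_restrict_dvd hle hPs hmem, map_zero]
  · obtain ⟨s, hs, hPi, hPs⟩ := exists_dvd_P_of_mul_eq_prod (degree_charpoly_ne_zero _) hmul hi
    refine ⟨s, hs, Or.inl fun v => aeval_apply_eq_zero_of_charpoly_restrict_dvd hle hPi ?_⟩
    rw [← ρ.self_inv_apply δ v, ← apply_δ_aeval_σ₁]
    exact hN δ _ (aeval_apply_mem_of_charpoly_mapQ_dvd hle hPs _)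

theorem isIrreducible_paramRep [NeZero d] {p : Param K d} (hp : p ∈ paramSpace K d)
    (hd : d ≤ 5) (hQ : ∀ r s, r ≠ s → Q p r s ≠ 0) : (paramRep hp).IsIrreducible := by
  refine isIrreducible_of_forall fun N hN => ?_
  by_contra! hproper
  obtain ⟨s, hs, h⟩ := exists_aeval_aeval_eq_zero_of_invariant
    (hasParam_paramRep hp hd).charpoly_eq hN hproper.1 hproper.2 0
  obtain ⟨n, rfl⟩ := exists_eq_add_two_of_ne hs
  have hid := aeval_paramRep_identity hp (by omega) hs
  have hne : Q p 0 s • (Pi.single 0 1 : Fin (n + 2) → K) ≠ 0 :=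
    smul_ne_zero (hQ 0 s hs.symm) (Pi.single_ne_zero_iff.2 one_ne_zero)
  rcases h with h | h
  · exact hne (hid.symm.trans (h _))
  · have h0 := h (aeval (paramRep hp σ₂) (P p.1 s) (Pi.single 0 1))
    rw [hid, map_smul, smul_eq_zero_iff_right (hQ 0 s hs.symm)] at h0
    exact hne (by rw [← hid, h0, map_zero])

end Existence

section Classification

variable {K : Type*} [Field K] [IsAlgClosed K] {d : ℕ}

theorem HasParam.notMem_excludedLocus {V : Type*} [AddCommGroup V] [Module K V]
    [FiniteDimensional K V] {ρ : Representation K B3 V} {p : Param K d} (h : HasParam ρ p)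
    (hρ : ρ.IsIrreducible) (hd : d ≤ 5) : p ∉ excludedLocus K d := fun hp =>
  have ⟨_, _, hrs, hQ⟩ := exists_Q_eq_zero_of_isExcluded hp
  h.Q_ne_zero hρ hd hrs hQ

variable [NeZero d]

theorem nonempty_equiv_of_hasParam {V W : Type*} [AddCommGroup V] [Module K V]
    [FiniteDimensional K V] [AddCommGroup W] [Module K W] [FiniteDimensional K W]
    {ρ : Representation K B3 V} {ρ' : Representation K B3 W} (hρ : ρ.IsIrreducible)
    (hρ' : ρ'.IsIrreducible) (hd : d ≤ 5) {p : Param K d} (h : HasParam ρ p)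
    (h' : HasParam ρ' p) : Nonempty (ρ.Equiv ρ') := by
  obtain ⟨e⟩ := h.nonempty_equiv_paramRep hρ hd
  obtain ⟨e'⟩ := h'.nonempty_equiv_paramRep hρ' hd
  exact ⟨e.trans e'.symm⟩

theorem nonempty_equiv_iff_exists_hasParam {V W : Type*} [AddCommGroup V] [Module K V]
    [FiniteDimensional K V] [AddCommGroup W] [Module K W] [FiniteDimensional K W]
    {ρ : Representation K B3 V} {ρ' : Representation K B3 W} (hρ : ρ.IsIrreducible)
    (hρ' : ρ'.IsIrreducible) (hd5 : d ≤ 5) (hd : Module.finrank K V = d) :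
    Nonempty (ρ.Equiv ρ') ↔ ∃ p : Param K d, HasParam ρ p ∧ HasParam ρ' p := by
  constructor
  · rintro ⟨e⟩
    obtain ⟨p, hp⟩ := exists_hasParam hρ hd5 hd
    exact ⟨p, hp, hp.of_equiv e⟩
  · rintro ⟨p, hp, hp'⟩
    exact nonempty_equiv_of_hasParam hρ hρ' hd5 hp hp'

theorem exists_isIrreducible_hasParam_iff (hd : d ≤ 5) {p : Param K d} (hp : p ∈ paramSpace K d) :
    (∃ ρ : Representation K B3 (Fin d → K), ρ.IsIrreducible ∧ HasParam ρ p) ↔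
      ∀ r s, r ≠ s → Q p r s ≠ 0 :=
  ⟨fun ⟨_, hρ, h⟩ _ _ hrs => h.Q_ne_zero hρ hd hrs,
    fun hQ => ⟨paramRep hp, isIrreducible_paramRep hp hd hQ, hasParam_paramRep hp hd⟩⟩

theorem exists_hasParam_mk_eq_iff (hd : d ≤ 5)
    (ρ : {ρ : Representation K B3 (Fin d → K) // ρ.IsIrreducible}) :
    ∃ x : ParamOrbits K d, ∀ p : ↥(paramSpace K d \ excludedLocus K d),
      HasParam ρ.1 p.1 ↔ x = Quotient.mk _ p := by
  have := nontrivial_of_isIrreducible ρ.2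
  obtain ⟨q, hq⟩ := exists_hasParam ρ.2 hd (Module.finrank_fin_fun K)
  exact ⟨Quotient.mk _ ⟨q, hq.mem, hq.notMem_excludedLocus ρ.2 hd⟩, fun p =>
    hq.iff_sameOrbit.trans ⟨fun h => Quotient.sound h, fun h => Quotient.exact h⟩⟩

theorem exists_equiv_paramOrbits (hd : d ≤ 5) :
    ∃ Φ : SimpleClasses K d ≃ ParamOrbits K d,
      ∀ (ρ : {ρ : Representation K B3 (Fin d → K) // ρ.IsIrreducible})
        (p : ↥(paramSpace K d \ excludedLocus K d)),
        HasParam ρ.1 p.1 ↔ Φ (Quotient.mk _ ρ) = Quotient.mk _ p := by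
  choose φ hφ using exists_hasParam_mk_eq_iff (K := K) (d := d) hd
  have hequiv (ρ ρ' : {ρ : Representation K B3 (Fin d → K) // ρ.IsIrreducible}) :
      Nonempty (ρ.1.Equiv ρ'.1) ↔ φ ρ = φ ρ' := by
    obtain ⟨p, hp⟩ := Quotient.exists_rep (φ ρ')
    have hρ' : HasParam ρ'.1 p.1 := (hφ ρ' p).2 hp.symm
    rw [← hp]
    exact ⟨fun ⟨e⟩ => (hφ ρ p).1 (hρ'.of_equiv e.symm),
      fun h => nonempty_equiv_of_hasParam ρ.2 ρ'.2 hd ((hφ ρ p).2 h) hρ'⟩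
  let Φ : SimpleClasses K d → ParamOrbits K d := Quotient.lift φ fun ρ ρ' => (hequiv ρ ρ').1
  have hinj : Function.Injective Φ := by
    rintro ⟨ρ⟩ ⟨ρ'⟩ h
    exact Quotient.sound ((hequiv ρ ρ').2 h)
  have hsurj : Function.Surjective Φ := by
    rintro ⟨p⟩
    obtain ⟨ρ, hρ, h⟩ := (exists_isIrreducible_hasParam_iff hd p.2.1).2 fun r s hrs hQ =>
      p.2.2 (isExcluded_of_Q_eq_zero p.2.1 hrs hQ)
    exact ⟨Quotient.mk _ ⟨ρ, hρ⟩, (hφ ⟨ρ, hρ⟩ p).1 h⟩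
  exact ⟨Equiv.ofBijective Φ ⟨hinj, hsurj⟩, hφ⟩

end Classification

end B3

open B3 in
theorem mainTheorem1 {K : Type*} [Field K] [IsAlgClosed K] (d : ℕ) (hd1 : 1 ≤ d) (hd5 : d ≤ 5) :
    -- every simple module has a parameter, unique up to permuting the eigenvalues,
    -- and all the `Q r s` are nonzero there
    (∀ (V : Type*) [AddCommGroup V] [Module K V] [FiniteDimensional K V]
        (ρ : Representation K B3 V), ρ.IsIrreducible → Module.finrank K V = d →
        ∃ p : Param K d, (∀ q : Param K d, HasParam ρ q ↔ SameOrbit p q) ∧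
          ∀ r s, r ≠ s → Q p r s ≠ 0) ∧
    -- a simple module is determined by its parameter
    (∀ (V : Type*) [AddCommGroup V] [Module K V] [FiniteDimensional K V]
        (W : Type*) [AddCommGroup W] [Module K W] [FiniteDimensional K W]
        (ρ : Representation K B3 V) (τ : Representation K B3 W),
        ρ.IsIrreducible → τ.IsIrreducible →
        Module.finrank K V = d → Module.finrank K W = d →
        (Nonempty (ρ.Equiv τ) ↔ ∃ p : Param K d, HasParam ρ p ∧ HasParam τ p)) ∧
    -- a simple module with a given parameter exists if and only if all `Q r s` are nonzero
    (∀ p ∈ paramSpace K d,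
        (∃ ρ : Representation K B3 (Fin d → K), ρ.IsIrreducible ∧ HasParam ρ p) ↔
          ∀ r s, r ≠ s → Q p r s ≠ 0) ∧
    -- `Q r s` is the scalar with `P_r(A) P_s(B) P_r(A) = Q_{rs} P_r(A)`, and `P_r(A) ≠ 0`
    (∀ (V : Type*) [AddCommGroup V] [Module K V] [FiniteDimensional K V]
        (ρ : Representation K B3 V) (p : Param K d), ρ.IsIrreducible → HasParam ρ p →
        ∀ r s, r ≠ s → aeval (ρ σ₁) (P p.1 r) ≠ 0 ∧
          aeval (ρ σ₁) (P p.1 r) * aeval (ρ σ₂) (P p.1 s) * aeval (ρ σ₁) (P p.1 r) =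
            Q p r s • aeval (ρ σ₁) (P p.1 r)) ∧
    -- equivalence classes correspond bijectively to orbits in `X_d \ N_d`
    (∃ Φ : SimpleClasses K d ≃ ParamOrbits K d,
        ∀ (ρ : {ρ : Representation K B3 (Fin d → K) // ρ.IsIrreducible})
          (p : ↥(paramSpace K d \ excludedLocus K d)),
          HasParam ρ.1 p.1 ↔ Φ (Quotient.mk _ ρ) = Quotient.mk _ p) := by
  have : NeZero d := ⟨by omega⟩
  refine ⟨?_, ?_, fun p hp => exists_isIrreducible_hasParam_iff hd5 hp, ?_,
    exists_equiv_paramOrbits hd5⟩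
  · intro V _ _ _ ρ hρ hd
    have := nontrivial_of_isIrreducible hρ
    obtain ⟨p, hp⟩ := exists_hasParam hρ hd5 hd
    exact ⟨p, fun q => hp.iff_sameOrbit, fun r s hrs => hp.Q_ne_zero hρ hd5 hrs⟩
  · intro V _ _ _ W _ _ _ ρ τ hρ hτ hd _
    exact nonempty_equiv_iff_exists_hasParam hρ hτ hd5 hd
  · intro V _ _ _ ρ p hρ hp r s hrs
    exact ⟨hp.aeval_ne_zero hρ hd5 hrs, hp.aeval_mul_aeval_mul_aeval hρ hd5 hrs⟩
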